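/- An overpartition of $n$ is a finite non-increasing sequence of positive integers $\lambda_1\ge\cdots\ge\lambda_s$ with sum $n$ in which the first occurrence of each number may be overlined. Let $A=\{a(1),\dots,a(r)\}$ be a set of $r$ distinct integers such that $\sum_{i=1}^{k-1}a(i)<a(k)$ for all $1\le k\le r$ and such that the $2^r-1$ sums of distinct elements of $A$ (over the nonempty subsets of $A$) are all distinct; let $A'$ be the set of these sums. For $\alpha\in A'$ let $w(\alpha)$ be the number of terms in the defining sum of $\alpha$ and $v(\alpha)$ the smallest $a(i)$ appearing in it. Let $N$ be a positive integer with $N\ge a(1)+\cdots+a(r)$, and let $\beta_N(m)\in\{1,\dots,N\}$ be the least positive residue of $m$ modulo $N$. Let $-A_N$ (resp. $-A'_N$) be the set of positive integers congruent modulo $N$ to $-\alpha$ for some $\alpha\in A$ (resp. $\alpha\in A'$). For integers $k,n\ge 0$, let $F(-A_N;k,n)$ be the number of overpartitions of $n$ into parts taken from $-A_N$ having $k$ non-overlined parts. Let $G(-A'_N;k,n)$ be the number of overpartitions $n=\lambda_1+\cdots+\lambda_s$ into parts taken from $-A'_N$ having $k$ non-overlined parts, such that for all $1\le i\le s-1$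 $$\lambda_i-\lambda_{i+1}\ \ge\ N\bigl(w(\beta_N(-\lambda_i))-1+\chi(\overline{\lambda_{i+1}})\bigr)+v(\beta_N(-\lambda_i))-\beta_N(-\lambda_i),$$ where $\chi(\overline{\lambda_{i+1}})=1$ if $\lambda_{i+1}$ is overlined and $0$ otherwise, and such that (if $s\ge1$) $$\lambda_s\ \ge\ N\bigl(w(\beta_N(-\lambda_s))-1\bigr).$$ Then $F(-A_N;k,n)=G(-A'_N;k,n)$. -/

import Mathlib

/-- `l` is an overpartition of `n`: a finite non-increasing sequence of positive integers with sum
`n` in which the first occurrence of a number may be overlined. An entry `(m, b)` is a part of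
size `m`, overlined exactly when `b = true`; a part preceded by a part of the same size is not a
first occurrence, hence not overlined. -/
def IsOverpartition (n : ℕ) (l : List (ℕ × Bool)) : Prop :=
  (∀ x ∈ l, 0 < x.1) ∧
  l.Pairwise (fun x y => y.1 ≤ x.1 ∧ (x.1 = y.1 → y.2 = false)) ∧
  (l.map Prod.fst).sum = n

/-- There are finitely many overpartitions of `n`, so cardinalities of sets of them are genuine. -/
theorem finite_setOf_isOverpartition (n : ℕ) : {l | IsOverpartition n l}.Finite := by
  have hfin : ((fun l : List (Fin (n + 1) × Bool) => l.map (fun x => ((x.1 : ℕ), x.2))) ''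
      {l | l.length ≤ n}).Finite := (List.finite_length_le _ n).image _
  refine hfin.subset ?_
  rintro l ⟨hpos, -, hsum⟩
  have hle : ∀ x ∈ l, x.1 < n + 1 := by
    intro x hx
    have := List.single_le_sum (l := l.map Prod.fst) (by simp) x.1 (List.mem_map_of_mem hx)
    omega
  have hlen : l.length ≤ n := by
    have h := List.card_nsmul_le_sum (l.map Prod.fst) 1 (by
      intro x hx
      obtain ⟨y, hy, rfl⟩ := List.mem_map.1 hx
      exact hpos y hy)
    simp at h
    rw [hsum] at h
    exact h
  refine ⟨l.pmap (fun x (hx : x.1 < n + 1) => ((⟨x.1, hx⟩ : Fin (n + 1)), x.2)) hle, ?_, ?_⟩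
  · simpa using hlen
  · simp [List.map_pmap]

/-- The number of non-overlined parts. -/
def numNonOverlined (l : List (ℕ × Bool)) : ℕ :=
  l.countP (fun x => !x.2)

/-- `χ` of a part: `1` if it is overlined and `0` otherwise. -/
def overlineChi (x : ℕ × Bool) : ℤ :=
  if x.2 = true then 1 else 0

/-- The set `A = {a(1), …, a(r)}`. -/
def baseSet {r : ℕ} (a : Fin r → ℤ) : Set ℤ :=
  Set.range a

/-- The set `A'` of the sums of the nonempty sets of elements of `A`. -/
def sumSet {r : ℕ} (a : Fin r → ℤ) : Set ℤ :=
  {α | ∃ S : Finset (Fin r), S.Nonempty ∧ ∑ i ∈ S, a i = α}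

/-- The set of positive integers congruent modulo `N` to `-s` for some `s ∈ S`; for `S = A` and
`S = A'` these are `-A_N` and `-A'_N`. -/
def negResidueSet (N : ℤ) (S : Set ℤ) : Set ℕ :=
  {m | 0 < m ∧ ∃ s ∈ S, (m : ℤ) ≡ -s [ZMOD N]}

/-- `β_N(m)`: the least positive residue of `m` modulo `N`, an element of `{1, …, N}`. -/
def leastPosResidue (N m : ℤ) : ℤ :=
  if m % N = 0 then N else m % N

theorem leastPosResidue_spec {N : ℤ} (hN : 0 < N) (m : ℤ) :
    IsLeast {b : ℤ | 0 < b ∧ b ≡ m [ZMOD N]} (leastPosResidue N m) := by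
  have h0 := Int.emod_nonneg m hN.ne'
  have h1 := Int.emod_lt_of_pos m hN
  unfold leastPosResidue
  split_ifs with h
  · refine ⟨⟨hN, ?_⟩, ?_⟩
    · simp [Int.ModEq, h]
    · rintro b ⟨hb, hbm⟩
      have hb0 : b % N = 0 := by rw [← h]; exact hbm
      exact Int.le_of_dvd hb (Int.dvd_of_emod_eq_zero hb0)
  · refine ⟨⟨by omega, Int.mod_modEq m N⟩, ?_⟩
    rintro b ⟨hb, hbm⟩
    have hb' : b % N = m % N := hbm
    by_cases hlt : b < N
    · rw [← hb', Int.emod_eq_of_lt hb.le hlt]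
    · omega

open Classical in
/-- The (indices of the) terms of the defining sum of `α ∈ A'`; empty if `α ∉ A'`. -/
noncomputable def summands {r : ℕ} (a : Fin r → ℤ) (α : ℤ) : Finset (Fin r) :=
  if h : ∃ S : Finset (Fin r), S.Nonempty ∧ ∑ i ∈ S, a i = α then h.choose else ∅

/-- When the sums of distinct elements of `A` are pairwise distinct, the defining sum is unique. -/
theorem summands_sum {r : ℕ} {a : Fin r → ℤ}
    (ha : Set.InjOn (fun S : Finset (Fin r) => ∑ i ∈ S, a i) {S | S.Nonempty})
    {S : Finset (Fin r)} (hS : S.Nonempty) : summands a (∑ i ∈ S, a i) = S := by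
  have h : ∃ T : Finset (Fin r), T.Nonempty ∧ ∑ i ∈ T, a i = ∑ i ∈ S, a i := ⟨S, hS, rfl⟩
  rw [summands, dif_pos h]
  exact ha h.choose_spec.1 hS h.choose_spec.2

/-- `w(α)`: the number of terms in the defining sum of `α`. -/
noncomputable def sumWeight {r : ℕ} (a : Fin r → ℤ) (α : ℤ) : ℤ :=
  ((summands a α).card : ℤ)

/-- `v(α)`: the smallest `a(i)` in the defining sum of `α` (`0` if `α ∉ A'`). -/
noncomputable def sumMin {r : ℕ} (a : Fin r → ℤ) (α : ℤ) : ℤ :=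
  if h : (summands a α).Nonempty then (summands a α).inf' h a else 0

/-- The overpartitions of `n` into parts from `-A_N` with `k` non-overlined parts. -/
def overpartitionsF {r : ℕ} (a : Fin r → ℤ) (N : ℤ) (k n : ℕ) : Set (List (ℕ × Bool)) :=
  {l | IsOverpartition n l ∧ numNonOverlined l = k ∧
    ∀ x ∈ l, x.1 ∈ negResidueSet N (baseSet a)}

/-- The difference condition between consecutive parts `x = λ_i` and `y = λ_{i+1}`. -/
def GapCondition {r : ℕ} (a : Fin r → ℤ) (N : ℤ) (x y : ℕ × Bool) : Prop :=
  (x.1 : ℤ) - (y.1 : ℤ) ≥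
    N * (sumWeight a (leastPosResidue N (-(x.1 : ℤ))) - 1 + overlineChi y)
      + sumMin a (leastPosResidue N (-(x.1 : ℤ))) - leastPosResidue N (-(x.1 : ℤ))

/-- The overpartitions of `n` into parts from `-A'_N` with `k` non-overlined parts, whose
consecutive parts satisfy the difference condition and whose smallest part `λ_s` (if any) satisfies
`λ_s ≥ N (w(β_N(-λ_s)) - 1)`. -/
def overpartitionsG {r : ℕ} (a : Fin r → ℤ) (N : ℤ) (k n : ℕ) : Set (List (ℕ × Bool)) :=
  {l | IsOverpartition n l ∧ numNonOverlined l = k ∧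
    (∀ x ∈ l, x.1 ∈ negResidueSet N (sumSet a)) ∧
    l.IsChain (GapCondition a N) ∧
    ∀ x ∈ l.getLast?,
      (x.1 : ℤ) ≥ N * (sumWeight a (leastPosResidue N (-(x.1 : ℤ))) - 1)}

/-! A part from `-A'_N` is uniquely `N * m - blockSum a B`, with `m` its height and `B` a strictly
decreasing block of indices. Each element of `A` exceeds the sum of the earlier ones, so dividing
the difference condition by `N` leaves `m ≥ m' + |B| - 1 + χ + [head B' < last B]`, where `m'`,
`B'`, `χ` belong to the next part. A partition counted by `G` is therefore a list of codes: blocks,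
overline marks and free slacks `e ≥ 0`. Its size is `N * codeStat 0 c` minus the sum of `a` over the
letters. A partition counted by `F` splits by residue, and each class is a code list in one letter.
So `a` and `N` drop out: for each multiset of letters, codes and families of one-letter codes must
have the same joint distribution of `codeStat 0` and of the number of plain parts
(`nonempty_equiv_codes`).

Concatenating the blocks gives a word `w`; the codes over `w` arise by cutting it at every
non-descent and at any chosen descents. Their generating function is `q ^ (L + maj - L * des) *
c_L(d * q ^ des)`, where `L` is the length and `c_L` is `overCoeff` (`hasGF_codesOfWord`). It
remains to see that the sum `S(d)` of these weights over all rearrangements of `n` letters equals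
the product `P(d)` of the weights of the constant words (`sum_wordWeight`). Replacing `d` by `d * q`
gives one recurrence removing the first letter and one removing the last. Switching one letter at a
time (`sum_words_sub_prod_eq`), with induction on `n`, the first yields `S(dq) - P(dq) = q^n (S(d) -
P(d))` and the second `S(dq) - P(dq) = S(d) - P(d)`. Since `1 - q^n ≠ 0` for `n ≥ 1`, `S = P`.

Coding needs `a i < N`, lest a coded part have size zero. This can fail only for `r = 1`, where `A'
= A` and the two sets coincide. -/

/-- The words whose multiset of letters is `u`. -/
def words {ι : Type*} [DecidableEq ι] (u : Multiset ι) : Finset (List ι) :=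
  (Multiset.lists u).toFinset

theorem mem_words {ι : Type*} [DecidableEq ι] {u : Multiset ι} {w : List ι} :
    w ∈ words u ↔ (w : Multiset ι) = u := by
  rw [words, Multiset.mem_toFinset, Multiset.mem_lists_iff]
  exact eq_comm

theorem words_zero {ι : Type*} [DecidableEq ι] : words (0 : Multiset ι) = {[]} := by
  ext w
  simp [mem_words]

theorem sum_words_reverse {ι K : Type*} [DecidableEq ι] [AddCommMonoid K] (u : Multiset ι)
    (φ : List ι → K) : ∑ w ∈ words u, φ w.reverse = ∑ w ∈ words u, φ w := by
  refine Finset.sum_nbij' List.reverse List.reverse ?_ ?_ ?_ ?_ ?_ <;>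
    simp [mem_words]

/-- Words with a prescribed first letter correspond to words in the remaining letters. -/
theorem sum_words_head? {ι K : Type*} [DecidableEq ι] [AddCommMonoid K] (u : Multiset ι) (a : ι)
    (φ : List ι → K) :
    ∑ w ∈ words u, (if w.head? = some a then φ w else 0) =
      if a ∈ u then ∑ w ∈ words (u.erase a), φ (a :: w) else 0 := by
  rw [← Finset.sum_filter]
  split_ifs with h
  · symm
    refine Finset.sum_nbij' (fun w => a :: w) List.tail ?_ ?_ ?_ ?_ ?_
    · intro w hw
      rw [mem_words] at hw
      simp [mem_words, ← Multiset.cons_coe, hw, Multiset.cons_erase h]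
    · intro w hw
      obtain ⟨h1, h2⟩ := Finset.mem_filter.1 hw
      rw [mem_words] at h1 ⊢
      cases w with
      | nil => simp at h2
      | cons b w =>
        obtain rfl : b = a := by simpa using h2
        simp [← h1]
    · intro w _
      simp
    · intro w hw
      obtain ⟨h1, h2⟩ := Finset.mem_filter.1 hw
      cases w with
      | nil => simp at h2
      | cons b w =>
        obtain rfl : b = a := by simpa using h2
        simp
    · intro w _
      rfl
  · refine Finset.sum_eq_zero fun w hw => ?_
    obtain ⟨h1, h2⟩ := Finset.mem_filter.1 hw
    rw [mem_words] at h1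
    cases w with
    | nil => simp at h2
    | cons b w =>
      obtain rfl : b = a := by simpa using h2
      simp [← h1] at h

/-! ### The q-binomial coefficients and the shift from `d` to `d * q`. -/

section Coefficients

variable {K : Type*} [Field K]

/-- The coefficient of `x ^ n` in `∏ (1 + x q ^ m) / (1 - d x q ^ m)`, the product being over
`m ≥ 0`. -/
def overCoeff (q d : K) (n : ℕ) : K :=
  ∏ j ∈ Finset.range n, (d + q ^ j) / (1 - q ^ (j + 1))

theorem overCoeff_zero (q d : K) : overCoeff q d 0 = 1 := by
  simp [overCoeff]

theorem overCoeff_succ (q d : K) (n : ℕ) :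
    overCoeff q d (n + 1) = overCoeff q d n * ((d + q ^ n) / (1 - q ^ (n + 1))) := by
  rw [overCoeff, Finset.prod_range_succ, overCoeff]

/-- The shift telescopes: `d * q + q ^ (j + 1) = q * (d + q ^ j)`, so only the factor `d * q + 1` is
new. -/
theorem overCoeff_mul_succ {q : K} (hq : ∀ j : ℕ, 1 - q ^ (j + 1) ≠ 0) (d : K) (n : ℕ) :
    overCoeff q (d * q) (n + 1) =
      q ^ n * (1 + d * q) / (1 - q ^ (n + 1)) * overCoeff q d n := by
  induction n with
  | zero => simp [overCoeff_succ, overCoeff_zero, add_comm]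
  | succ n ih =>
    rw [overCoeff_succ, ih, overCoeff_succ]
    have h1 := hq n
    have h2 := hq (n + 1)
    field_simp
    ring

/-- With `Φ_d(x)` the infinite product, this compares coefficients in `Φ_{dq}(x) = (1 + x) * Φ_d(q *
x)`. -/
theorem overCoeff_mul_eq_prefix {q : K} (hq : ∀ j : ℕ, 1 - q ^ (j + 1) ≠ 0) (d : K) (n : ℕ) :
    overCoeff q (d * q) (n + 1) = q ^ (n + 1) * overCoeff q d (n + 1) + q ^ n * overCoeff q d n := by
  rw [overCoeff_mul_succ hq, overCoeff_succ]
  have h1 := hq n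
  field_simp
  ring

/-- Coefficientwise form of `Φ_{dq}(x) = (1 - d * x) * Φ_d(x)`. -/
theorem overCoeff_mul_eq_suffix {q : K} (hq : ∀ j : ℕ, 1 - q ^ (j + 1) ≠ 0) (d : K) (n : ℕ) :
    overCoeff q (d * q) (n + 1) = overCoeff q d (n + 1) - d * overCoeff q d n := by
  rw [overCoeff_mul_succ hq, overCoeff_succ]
  have h1 := hq n
  field_simp
  ring

end Coefficients

/-! ### Descent statistics of words and the summation over rearrangements. -/

section Words

variable {ι : Type*} [LinearOrder ι]

/-- `1` if the word `a :: w` starts with a descent and `0` otherwise. -/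
def headDescent (a : ι) : List ι → ℕ
  | [] => 0
  | b :: _ => if b < a then 1 else 0

/-- The number of descents of a word. -/
def descentNumber : List ι → ℕ
  | [] => 0
  | a :: w => headDescent a w + descentNumber w

/-- The exponent `L + maj w - L * des w` of a word `w` of length `L`. -/
def wordExponent : List ι → ℤ
  | [] => 0
  | a :: w => wordExponent w + 1 - headDescent a w * w.length

theorem descentNumber_append (w : List ι) (a : ι) :
    descentNumber (w ++ [a]) = descentNumber w + if ∃ b ∈ w.getLast?, a < b then 1 else 0 := by
  induction w with
  | nil => simp [descentNumber, headDescent]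
  | cons b w ih =>
    cases w with
    | nil => simp [descentNumber, headDescent]
    | cons c w =>
      have : headDescent b (c :: w ++ [a]) = headDescent b (c :: w) := rfl
      rw [List.cons_append, descentNumber, ih, this, List.getLast?_cons_cons, ← add_assoc]
      rfl

theorem wordExponent_append (w : List ι) (a : ι) :
    wordExponent (w ++ [a]) =
      wordExponent w + 1 - descentNumber w - if ∃ b ∈ w.getLast?, a < b then 1 else 0 := by
  induction w with
  | nil => simp [wordExponent, descentNumber, headDescent]
  | cons b w ih =>
    cases w with
    | nil => simp [wordExponent, descentNumber, headDescent]
    | cons c w =>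
      have h1 : headDescent b (c :: w ++ [a]) = headDescent b (c :: w) := rfl
      have h2 : wordExponent (b :: c :: w) =
        wordExponent (c :: w) + 1 - headDescent b (c :: w) * (c :: w).length := rfl
      have h3 : descentNumber (b :: c :: w) = headDescent b (c :: w) + descentNumber (c :: w) := rfl
      rw [List.cons_append, wordExponent, ih, h2, h3, List.getLast?_cons_cons, h1]
      push_cast [List.length_append, List.length_cons, List.length_nil]
      ring

variable {K : Type*} [Field K]

/-- The generating function of the coded overpartitions whose letters form the word `w`. -/
def wordWeight (q d : K) (w : List ι) : K :=
  q ^ wordExponent w * overCoeff q (d * q ^ descentNumber w) w.length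

theorem wordWeight_nil (q d : K) : wordWeight q d ([] : List ι) = 1 := by
  simp [wordWeight, wordExponent, overCoeff_zero]

/-- The prefix recurrence for `overCoeff` splits off a term of length `w.length`. If `a` starts a
descent, that term keeps the shifted `d * q` and its factor `q ^ w.length` cancels the drop of the
exponent; otherwise `d` is unshifted and the factor survives. For empty `w` the two cases agree. -/
theorem wordWeight_cons {q : K} (hq0 : q ≠ 0) (hq : ∀ j : ℕ, 1 - q ^ (j + 1) ≠ 0) (d : K) (a : ι)
    (w : List ι) :
    wordWeight q (d * q) (a :: w) = q ^ (w.length + 1) * wordWeight q d (a :: w) +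
      q * if ∀ b ∈ w.head?, b < a then wordWeight q (d * q) w
        else q ^ w.length * wordWeight q d w := by
  rcases w with _ | ⟨b, w⟩
  · have h := overCoeff_mul_eq_prefix hq d 0
    simp only [zero_add, pow_one, pow_zero, overCoeff_zero] at h
    simp [wordWeight, wordExponent, headDescent, descentNumber, overCoeff_zero, h]
    ring
  · generalize hv : b :: w = v
    have e1 : ∀ n : ℕ, d * q * q ^ n = d * q ^ n * q := fun n => by ring
    by_cases hb : b < a
    · have h1 : headDescent a v = 1 := by rw [← hv]; simp [headDescent, hb]
      have h2 : ∀ c ∈ v.head?, c < a := by rw [← hv]; simpa using hb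
      rw [if_pos h2]
      simp only [wordWeight, wordExponent, descentNumber, h1, List.length_cons]
      rw [e1, overCoeff_mul_eq_prefix hq,
        show d * q ^ (1 + descentNumber v) = d * q * q ^ descentNumber v by ring]
      rw [mul_add, ← mul_assoc, ← mul_assoc, ← mul_assoc, ← mul_assoc,
        mul_comm (q ^ (v.length + 1))]
      congr 2
      rw [← zpow_natCast, ← zpow_add₀ hq0, ← zpow_one_add₀ hq0]
      congr 1
      push_cast
      ring
    · have h1 : headDescent a v = 0 := by rw [← hv]; simp [headDescent, hb]
      have h2 : ¬ ∀ c ∈ v.head?, c < a := by rw [← hv]; simpa using hb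
      rw [if_neg h2]
      simp only [wordWeight, wordExponent, descentNumber, h1, List.length_cons]
      rw [e1, overCoeff_mul_eq_prefix hq]
      simp only [zero_add, Nat.cast_zero, zero_mul, sub_zero]
      rw [zpow_add_one₀ hq0]
      ring

/-- The suffix recurrence releases `d` times `q` to the descent number of the longer word. This
power cancels the descents subtracted in `wordExponent_append`, and `d * q` is left; a final descent
again keeps the parameter of `w` shifted. -/
theorem wordWeight_append {q : K} (hq0 : q ≠ 0) (hq : ∀ j : ℕ, 1 - q ^ (j + 1) ≠ 0) (d : K)
    (w : List ι) (a : ι) :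
    wordWeight q (d * q) (w ++ [a]) = wordWeight q d (w ++ [a]) +
      -(d * q) * if ∀ b ∈ w.getLast?, a < b then wordWeight q (d * q) w else wordWeight q d w := by
  rcases w.eq_nil_or_concat with rfl | ⟨w', b, hw⟩
  · have h := overCoeff_mul_eq_suffix hq d 0
    simp only [zero_add, overCoeff_zero] at h
    simp [wordWeight, wordExponent, headDescent, descentNumber, overCoeff_zero, h]
    ring
  · have hl : w.getLast? = some b := by simp [hw]
    have hne : ∀ n : ℕ, q ^ n ≠ 0 := fun n => pow_ne_zero n hq0
    have e1 : ∀ n : ℕ, d * q * q ^ n = d * q ^ n * q := fun n => by ring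
    simp only [wordWeight, wordExponent_append, descentNumber_append, hl, List.length_append,
      List.length_singleton, Option.mem_def, Option.some.injEq, exists_eq_left', forall_eq']
    rw [e1, overCoeff_mul_eq_suffix hq]
    by_cases hb : a < b
    · simp only [hb, if_true]
      rw [show d * q ^ (descentNumber w + 1) = d * q * q ^ descentNumber w by ring,
        show wordExponent w + 1 - (descentNumber w : ℤ) - 1 = wordExponent w - (descentNumber w : ℕ)
          by ring, zpow_sub₀ hq0, zpow_natCast]
      have := hne (descentNumber w)
      field_simp
      ring
    · simp only [hb, if_false]
      rw [sub_zero, zpow_sub₀ hq0, zpow_add_one₀ hq0, zpow_natCast]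
      have := hne (descentNumber w)
      field_simp
      ring_nf

/-- Two families of sums over words agree with products up to the same error, if both satisfy the
recurrences coming from prepending letters in the order given by `p`. -/
theorem sum_words_sub_prod_eq {r : ℕ} (p : Equiv.Perm (Fin r)) (κ : K)
    (Ψ₁ Ψ₂ : List (Fin r) → K) (hΨ0 : Ψ₁ [] = Ψ₂ [])
    (hΨ : ∀ a w, Ψ₁ (a :: w) =
      Ψ₂ (a :: w) + κ * if ∀ b ∈ w.head?, p b < p a then Ψ₁ w else Ψ₂ w)
    (g₁ g₂ : ℕ → K) (h0 : g₁ 0 = g₂ 0) (hg : ∀ n, g₁ (n + 1) = g₂ (n + 1) + κ * g₂ n) (n : ℕ)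
    (ih : ∀ v : Multiset (Fin r), v.card < n → ∑ w ∈ words v, Ψ₂ w = ∏ i, g₂ (v.count i))
    (u : Multiset (Fin r)) (hu : u.card = n) :
    ∑ w ∈ words u, Ψ₁ w - ∏ i, g₁ (u.count i) = ∑ w ∈ words u, Ψ₂ w - ∏ i, g₂ (u.count i) := by
  -- `A` interpolates from `Ψ₂` at `t = 0` to `Ψ₁` at `t = r`, by the rank under `p` of the first
  -- letter. Raising `t` by one affects only words starting with the letter of rank `t`; by `hΨ` the
  -- change is `κ` times the same interpolated sum over the remaining letters. `B` obeys the same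
  -- recurrence by `hg`.
  set A : ℕ → Multiset (Fin r) → K := fun t v =>
    ∑ w ∈ words v, if ∀ b ∈ w.head?, (p b : ℕ) < t then Ψ₁ w else Ψ₂ w with hA
  set B : ℕ → Multiset (Fin r) → K := fun t v =>
    ∏ i, if (p i : ℕ) < t then g₁ (v.count i) else g₂ (v.count i) with hB
  have hA0 : ∀ v, A 0 v = ∑ w ∈ words v, Ψ₂ w := by
    intro v
    refine Finset.sum_congr rfl fun w _ => ?_
    cases w <;> simp [hΨ0]
  have hAr : ∀ v, A r v = ∑ w ∈ words v, Ψ₁ w := by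
    intro v
    refine Finset.sum_congr rfl fun w _ => ?_
    rw [if_pos]
    intro b _
    exact (p b).isLt
  have hB0 : ∀ v, B 0 v = ∏ i, g₂ (v.count i) := by
    intro v
    simp [hB]
  have hBr : ∀ v, B r v = ∏ i, g₁ (v.count i) := by
    intro v
    simp [hB]
  have hAs : ∀ (t : ℕ) (ht : t < r) v, A (t + 1) v =
      A t v + if p.symm ⟨t, ht⟩ ∈ v then κ * A t (v.erase (p.symm ⟨t, ht⟩)) else 0 := by
    intro t ht v
    have key : (if p.symm ⟨t, ht⟩ ∈ v then κ * A t (v.erase (p.symm ⟨t, ht⟩)) else 0) =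
        ∑ w ∈ words v, if w.head? = some (p.symm ⟨t, ht⟩) then Ψ₁ w - Ψ₂ w else 0 := by
      rw [sum_words_head?]
      congr 1
      rw [hA, Finset.mul_sum]
      refine Finset.sum_congr rfl fun w _ => ?_
      rw [hΨ, add_sub_cancel_left]
      simp [Fin.lt_def]
    rw [key, ← Finset.sum_add_distrib]
    refine Finset.sum_congr rfl fun w _ => ?_
    rcases w with _ | ⟨b, w⟩
    · simp
    · simp only [List.head?_cons, Option.mem_def, Option.some.injEq, forall_eq']
      rcases lt_trichotomy (p b : ℕ) t with h | h | h
      · have : b ≠ p.symm ⟨t, ht⟩ := by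
          rintro rfl
          simp at h
        simp [h, this, h.trans (Nat.lt_succ_self t)]
      · have : b = p.symm ⟨t, ht⟩ := by
          rw [Equiv.eq_symm_apply]
          exact Fin.ext h
        rw [if_pos (by omega), if_neg (by omega), if_pos this]
        ring
      · have : b ≠ p.symm ⟨t, ht⟩ := by
          rintro rfl
          simp at h
        rw [if_neg (by omega), if_neg (by omega), if_neg this, add_zero]
  have hBs : ∀ (t : ℕ) (ht : t < r) v, B (t + 1) v =
      B t v + if p.symm ⟨t, ht⟩ ∈ v then κ * B t (v.erase (p.symm ⟨t, ht⟩)) else 0 := by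
    intro t ht v
    set a := p.symm ⟨t, ht⟩ with ha
    have hpa : (p a : ℕ) = t := by simp [ha]
    have hrest : ∀ (s : ℕ) (v' : Multiset (Fin r)), (s = t ∨ s = t + 1) →
        (v' = v ∨ v' = v.erase a) →
        ∏ i ∈ Finset.univ.erase a, (if (p i : ℕ) < s then g₁ (v'.count i) else g₂ (v'.count i)) =
        ∏ i ∈ Finset.univ.erase a, if (p i : ℕ) < t then g₁ (v.count i) else g₂ (v.count i) := by
      intro s v' hs hv'
      refine Finset.prod_congr rfl fun i hi => ?_
      have hia : i ≠ a := Finset.ne_of_mem_erase hi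
      have hpi : (p i : ℕ) ≠ t := by
        intro h
        apply hia
        rw [ha, Equiv.eq_symm_apply]
        exact Fin.ext h
      have hc : v'.count i = v.count i := by
        rcases hv' with rfl | rfl
        · rfl
        · exact Multiset.count_erase_of_ne hia v
      have hst : (p i : ℕ) < s ↔ (p i : ℕ) < t := by omega
      simp only [hc, hst]
    simp only [hB]
    rw [← Finset.mul_prod_erase _ _ (Finset.mem_univ a), hrest _ _ (Or.inr rfl) (Or.inl rfl),
      ← Finset.mul_prod_erase (a := a) _ (fun i => if (p i : ℕ) < t then g₁ (v.count i)
        else g₂ (v.count i)) (Finset.mem_univ a),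
      ← Finset.mul_prod_erase (a := a) _ (fun i => if (p i : ℕ) < t then g₁ ((v.erase a).count i)
        else g₂ ((v.erase a).count i)) (Finset.mem_univ a), hrest _ _ (Or.inl rfl) (Or.inr rfl)]
    have hlt : ¬ (p a : ℕ) < t := by omega
    rw [if_pos (show (p a : ℕ) < t + 1 by omega), if_neg hlt, if_neg hlt]
    by_cases hav : a ∈ v
    · rw [if_pos hav]
      obtain ⟨m, hm⟩ := Nat.exists_eq_succ_of_ne_zero (Multiset.count_ne_zero.2 hav)
      rw [Multiset.count_erase_self, hm, Nat.succ_sub_one, Nat.succ_eq_add_one, hg]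
      ring
    · rw [if_neg hav, Multiset.count_eq_zero_of_notMem hav, h0, add_zero]
  have hlow : ∀ t ≤ r, ∀ v : Multiset (Fin r), v.card < n → A t v = B t v := by
    intro t
    induction t with
    | zero =>
      intro _ v hv
      rw [hA0, hB0, ih v hv]
    | succ t iht =>
      intro ht v hv
      rw [hAs t ht, hBs t ht, iht (by omega) v hv]
      split_ifs with h
      · rw [iht (by omega) _ (lt_of_le_of_lt (Multiset.card_le_card (Multiset.erase_le _ _)) hv)]
      · rfl
  -- The increments at `u` involve only smaller multisets, where `A = B`, so the difference does not
  -- depend on `t`.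
  have htop : ∀ t ≤ r, A t u - B t u = A 0 u - B 0 u := by
    intro t
    induction t with
    | zero => intro _; rfl
    | succ t iht =>
      intro ht
      rw [hAs t ht, hBs t ht, ← iht (by omega)]
      split_ifs with h
      · rw [hlow t (by omega) _ ((Multiset.card_erase_lt_of_mem h).trans_eq hu)]
        ring
      · ring
  rw [← hAr, ← hBr, htop r le_rfl, hA0, hB0]

/-- The sum of the weights of all words with given letters factors over the letters. -/
theorem sum_wordWeight {r : ℕ} {q : K} (hq0 : q ≠ 0) (hq : ∀ j : ℕ, 1 - q ^ (j + 1) ≠ 0) (d : K)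
    (u : Multiset (Fin r)) :
    ∑ w ∈ words u, wordWeight q d w = ∏ i, q ^ u.count i * overCoeff q d (u.count i) := by
  induction hn : u.card using Nat.strong_induction_on generalizing u d with
  | _ n ih =>
  have hcount : ∀ (v : Multiset (Fin r)) (f : Fin r → K),
      ∏ i, q ^ v.count i * f i = q ^ v.card * ∏ i, f i := by
    intro v f
    rw [Finset.prod_mul_distrib, Finset.prod_pow_eq_pow_sum,
      Multiset.sum_count_eq_card (fun a _ => Finset.mem_univ a)]
  have hlen : ∀ v : Multiset (Fin r), ∑ w ∈ words v, q ^ w.length * wordWeight q d w =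
      q ^ v.card * ∑ w ∈ words v, wordWeight q d w := by
    intro v
    rw [Finset.mul_sum]
    refine Finset.sum_congr rfl fun w hw => ?_
    rw [← mem_words.1 hw, Multiset.coe_card]
  -- Removing first letters: the error at `d * q` is `q ^ n` times the error at `d`.
  have h1 := sum_words_sub_prod_eq (K := K) (r := r) (Equiv.refl _) q
    (fun w => wordWeight q (d * q) w) (fun w => q ^ w.length * wordWeight q d w)
    (by simp [wordWeight_nil]) (fun a w => by
      rw [wordWeight_cons hq0 hq d a w]
      simp)
    (fun m => q ^ m * overCoeff q (d * q) m) (fun m => q ^ m * (q ^ m * overCoeff q d m))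
    (by simp [overCoeff_zero])
    (fun m => by
      rw [overCoeff_mul_eq_prefix hq]
      ring) n
    (fun v hv => by
      rw [hlen, ih _ hv d v rfl, ← hcount])
    u hn
  -- Removing last letters, on reversed words: an appended letter makes a descent when it is the
  -- smaller one, hence the reversed order. Here the two errors are equal.
  have h2 := sum_words_sub_prod_eq (K := K) (r := r) Fin.revPerm (-(d * q))
    (fun w => wordWeight q (d * q) w.reverse) (fun w => wordWeight q d w.reverse)
    (by simp [wordWeight_nil])
    (fun a w => by
      rw [List.reverse_cons, wordWeight_append hq0 hq]
      simp)
    (fun m => q ^ m * overCoeff q (d * q) m) (fun m => q ^ m * overCoeff q d m)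
    (by simp [overCoeff_zero])
    (fun m => by
      rw [overCoeff_mul_eq_suffix hq]
      ring) n
    (fun v hv => by
      rw [sum_words_reverse v (fun w => wordWeight q d w), ih _ hv d v rfl])
    u hn
  rw [sum_words_reverse u (fun w => wordWeight q (d * q) w),
    sum_words_reverse u (fun w => wordWeight q d w)] at h2
  rw [hlen, hcount u (fun i => q ^ u.count i * overCoeff q d (u.count i)), hn, h2] at h1
  -- For `n = 0` the comparison is void, as `1 - q ^ 0 = 0`, and the identity is checked directly.
  rcases n with _ | n
  · obtain rfl := Multiset.card_eq_zero.1 hn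
    simp [words_zero, wordWeight_nil, overCoeff_zero]
  · rw [← mul_sub] at h1
    have h3 : (1 - q ^ (n + 1)) * (∑ w ∈ words u, wordWeight q d w -
        ∏ i, q ^ u.count i * overCoeff q d (u.count i)) = 0 := by
      linear_combination h1
    exact sub_eq_zero.1 ((mul_eq_zero.1 h3).resolve_left (hq n))

end Words

/-! ### Generating functions in `q` and `d` of sets with two statistics. -/

section GeneratingFunctions

/-- `p` is the generating function `∑ q ^ M x * d ^ k x` over the elements `x` of `S`, of which
only finitely many have a given value of `M`; here `q = PowerSeries.X` and `d = Polynomial.X`. -/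
def HasGF {α : Type*} (S : Set α) (M k : α → ℕ) (p : PowerSeries (Polynomial ℤ)) : Prop :=
  ∀ n, ∃ T : Finset α, (∀ x, x ∈ T ↔ x ∈ S ∧ M x = n) ∧
    PowerSeries.coeff n p = ∑ x ∈ T, (Polynomial.X : Polynomial ℤ) ^ k x

theorem coeff_sum_X_pow {α : Type*} (T : Finset α) (k : α → ℕ) (m : ℕ) :
    (∑ x ∈ T, (Polynomial.X : Polynomial ℤ) ^ k x).coeff m = (T.filter fun x => k x = m).card := by
  rw [Polynomial.finsetSum_coeff, Finset.card_filter]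
  push_cast
  refine Finset.sum_congr rfl fun x _ => ?_
  rw [Polynomial.coeff_X_pow]
  simp only [eq_comm]

namespace HasGF

variable {α β : Type*} {S S' : Set α} {M M' k k' : α → ℕ} {p p' : PowerSeries (Polynomial ℤ)}

theorem congr (h : HasGF S M k p) (hM : ∀ x ∈ S, M x = M' x) (hk : ∀ x ∈ S, k x = k' x) :
    HasGF S M' k' p := by
  intro n
  obtain ⟨T, hT, hp⟩ := h n
  refine ⟨T, fun x => ?_, ?_⟩
  · rw [hT]
    exact and_congr_right fun hx => by rw [hM x hx]
  · rw [hp]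
    exact Finset.sum_congr rfl fun x hx => by rw [hk x ((hT x).1 hx).1]

theorem singleton (x : α) (hM : M x = 0) (hk : k x = 0) : HasGF {x} M k 1 := by
  classical
  intro n
  refine ⟨if n = 0 then {x} else ∅, fun y => ?_, ?_⟩
  · split_ifs with h
    · subst h
      simp only [Finset.mem_singleton, Set.mem_singleton_iff]
      exact ⟨fun hy => ⟨hy, hy ▸ hM⟩, fun hy => hy.1⟩
    · simp only [Finset.notMem_empty, Set.mem_singleton_iff, false_iff, not_and]
      rintro rfl h'
      exact h (by omega)
  · rw [PowerSeries.coeff_one]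
    split_ifs <;> simp [hk]

theorem empty : HasGF (∅ : Set α) M k 0 :=
  fun n => ⟨∅, by simp, by simp⟩

theorem union (h : HasGF S M k p) (h' : HasGF S' M k p') (hd : Disjoint S S') :
    HasGF (S ∪ S') M k (p + p') := by
  classical
  intro n
  obtain ⟨T, hT, hp⟩ := h n
  obtain ⟨T', hT', hp'⟩ := h' n
  refine ⟨T ∪ T', fun x => ?_, ?_⟩
  · rw [Finset.mem_union, hT, hT', Set.mem_union]
    tauto
  · rw [Finset.sum_union, map_add, hp, hp']
    rw [Finset.disjoint_left]
    intro x hx hx'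
    exact Set.disjoint_left.1 hd ((hT x).1 hx).1 ((hT' x).1 hx').1

theorem biUnion {ι : Type*} [DecidableEq ι] (I : Finset ι) (s : ι → Set α)
    (q : ι → PowerSeries (Polynomial ℤ)) (h : ∀ i ∈ I, HasGF (s i) M k (q i))
    (hd : ∀ i j, i ≠ j → Disjoint (s i) (s j)) :
    HasGF (⋃ i ∈ I, s i) M k (∑ i ∈ I, q i) := by
  induction I using Finset.induction_on with
  | empty => simpa using empty
  | insert a I ha ih =>
    rw [Finset.set_biUnion_insert, Finset.sum_insert ha]
    refine (h a (Finset.mem_insert_self _ _)).union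
      (ih fun i hi => h i (Finset.mem_insert_of_mem hi)) ?_
    rw [Set.disjoint_iUnion₂_right]
    intro i hi
    exact hd a i (by rintro rfl; exact ha hi)

theorem image {M₁ k₁ : β → ℕ} {f : α → β} (h : HasGF S M k p) (hf : Set.InjOn f S)
    (hM : ∀ x ∈ S, M₁ (f x) = M x) (hk : ∀ x ∈ S, k₁ (f x) = k x) :
    HasGF (f '' S) M₁ k₁ p := by
  classical
  intro n
  obtain ⟨T, hT, hp⟩ := h n
  refine ⟨T.image f, fun y => ?_, ?_⟩
  · simp only [Finset.mem_image, Set.mem_image]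
    constructor
    · rintro ⟨x, hx, rfl⟩
      obtain ⟨h1, h2⟩ := (hT x).1 hx
      exact ⟨⟨x, h1, rfl⟩, by rw [hM x h1, h2]⟩
    · rintro ⟨⟨x, hx, rfl⟩, hn⟩
      exact ⟨x, (hT x).2 ⟨hx, by rw [← hM x hx, hn]⟩, rfl⟩
  · rw [Finset.sum_image, hp]
    · exact Finset.sum_congr rfl fun x hx => by rw [hk x ((hT x).1 hx).1]
    · intro x hx y hy hxy
      exact hf ((hT x).1 hx).1 ((hT y).1 hy).1 hxy

theorem shift (h : HasGF S M k p) (a : ℕ) :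
    HasGF S (fun x => a + M x) k (PowerSeries.X ^ a * p) := by
  intro n
  rw [PowerSeries.coeff_X_pow_mul']
  split_ifs with ha
  · obtain ⟨T, hT, hp⟩ := h (n - a)
    refine ⟨T, fun x => ?_, hp⟩
    rw [hT]
    refine and_congr_right fun _ => ?_
    show M x = n - a ↔ a + M x = n
    omega
  · refine ⟨∅, fun x => ?_, by simp⟩
    simp only [Finset.notMem_empty, false_iff, not_and]
    intro _ h
    omega

theorem prod {s : Set β} {M₁ k₁ : β → ℕ} {p₁ : PowerSeries (Polynomial ℤ)} (h : HasGF S M k p)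
    (h₁ : HasGF s M₁ k₁ p₁) :
    HasGF (S ×ˢ s) (fun x => M x.1 + M₁ x.2) (fun x => k x.1 + k₁ x.2) (p * p₁) := by
  classical
  intro n
  choose T hT hp using h
  choose T₁ hT₁ hp₁ using h₁
  refine ⟨(Finset.HasAntidiagonal.antidiagonal n).biUnion fun m => T m.1 ×ˢ T₁ m.2, fun x => ?_, ?_⟩
  · simp only [Finset.mem_biUnion, Finset.HasAntidiagonal.mem_antidiagonal, Finset.mem_product, hT, hT₁,
      Set.mem_prod]
    constructor
    · rintro ⟨m, hm, ⟨h1, h2⟩, h3, h4⟩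
      exact ⟨⟨h1, h3⟩, by omega⟩
    · rintro ⟨⟨h1, h2⟩, h3⟩
      exact ⟨(M x.1, M₁ x.2), h3, ⟨h1, rfl⟩, h2, rfl⟩
  · rw [PowerSeries.coeff_mul, Finset.sum_biUnion]
    · refine Finset.sum_congr rfl fun m _ => ?_
      rw [hp, hp₁, Finset.sum_mul_sum, Finset.sum_product]
      simp only [pow_add]
    · intro m _ m' _ hmm
      rw [Function.onFun, Finset.disjoint_left]
      intro x hx hx'
      rw [Finset.mem_product, hT, hT₁] at hx hx'
      apply hmm
      ext
      · rw [← hx.1.2, ← hx'.1.2]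
      · rw [← hx.2.2, ← hx'.2.2]

theorem pi {r : ℕ} (s : Fin r → Set α) (q : Fin r → PowerSeries (Polynomial ℤ))
    (h : ∀ i, HasGF (s i) M k (q i)) :
    HasGF {c : Fin r → α | ∀ i, c i ∈ s i} (fun c => ∑ i, M (c i)) (fun c => ∑ i, k (c i))
      (∏ i, q i) := by
  induction r with
  | zero =>
    have : {c : Fin 0 → α | ∀ i, c i ∈ s i} = {Fin.elim0} := by
      ext c
      simp [eq_iff_true_of_subsingleton]
    rw [this]
    simpa using singleton (M := fun _ : Fin 0 → α => 0) (k := fun _ => 0) Fin.elim0 rfl rfl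
  | succ r ih =>
    have h1 := (h 0).prod (ih (fun i => s i.succ) (fun i => q i.succ) fun i => h i.succ)
    have h2 := h1.image (f := fun x : α × (Fin r → α) => (Fin.cons x.1 x.2 : Fin (r + 1) → α))
      (M₁ := fun c => ∑ i, M (c i)) (k₁ := fun c => ∑ i, k (c i))
      (by
        rintro ⟨x, c⟩ _ ⟨x', c'⟩ _ hx
        obtain ⟨rfl, rfl⟩ := Fin.cons_injective2 hx
        rfl)
      (fun x _ => by simp [Fin.sum_univ_succ]) (fun x _ => by simp [Fin.sum_univ_succ])
    rw [Fin.prod_univ_succ]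
    convert h2 using 1
    ext c
    simp only [Set.mem_ofPred_eq, Set.mem_image, Set.mem_prod, Prod.exists]
    constructor
    · intro hc
      exact ⟨c 0, fun i => c i.succ, ⟨hc 0, fun i => hc i.succ⟩, Fin.cons_self_tail c⟩
    · rintro ⟨x, c', ⟨hx, hc'⟩, rfl⟩ i
      refine Fin.cases ?_ (fun i => ?_) i
      · simpa using hx
      · simpa using hc' i

/-- Sets with the same generating function have equinumerous fibres. -/
theorem nonempty_equiv {s : Set β} {M₁ k₁ : β → ℕ} (h : HasGF S M k p) (h₁ : HasGF s M₁ k₁ p)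
    (n m : ℕ) :
    Nonempty ({x // x ∈ S ∧ M x = n ∧ k x = m} ≃ {x // x ∈ s ∧ M₁ x = n ∧ k₁ x = m}) := by
  classical
  obtain ⟨T, hT, hp⟩ := h n
  obtain ⟨T₁, hT₁, hp₁⟩ := h₁ n
  have hcard : (T.filter fun x => k x = m).card = (T₁.filter fun x => k₁ x = m).card := by
    have := (coeff_sum_X_pow T k m).symm.trans ((congrArg (fun f : Polynomial ℤ => f.coeff m)
      (hp.symm.trans hp₁)).trans (coeff_sum_X_pow T₁ k₁ m))
    exact_mod_cast this
  have e1 : ∀ x, x ∈ T.filter (fun x => k x = m) ↔ x ∈ S ∧ M x = n ∧ k x = m := by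
    intro x
    rw [Finset.mem_filter, hT, and_assoc]
  have e2 : ∀ x, x ∈ T₁.filter (fun x => k₁ x = m) ↔ x ∈ s ∧ M₁ x = n ∧ k₁ x = m := by
    intro x
    rw [Finset.mem_filter, hT₁, and_assoc]
  exact ⟨(Equiv.subtypeEquivRight e1).symm.trans
    ((Finset.equivOfCardEq hcard).trans (Equiv.subtypeEquivRight e2))⟩

/-- The pairs of a slack `e` and an overline mark, at position `j + 1`. -/
theorem slack (j : ℕ) : ∃ g : PowerSeries (Polynomial ℤ),
    HasGF (Set.univ : Set (ℕ × Bool)) (fun x => (j + 1) * x.1 + if x.2 then j else 0)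
      (fun x => if x.2 then 0 else 1) g ∧
    (1 - PowerSeries.X ^ (j + 1)) * g = PowerSeries.C Polynomial.X + PowerSeries.X ^ j := by
  have h1 : HasGF (Set.univ : Set ℕ) (fun e => (j + 1) * e) (fun _ => 0)
      (PowerSeries.mk fun n => if j + 1 ∣ n then 1 else 0) := by
    intro n
    rw [PowerSeries.coeff_mk]
    split_ifs with h
    · obtain ⟨m, rfl⟩ := h
      refine ⟨{m}, fun x => ?_, by simp⟩
      simp
    · refine ⟨∅, fun x => ?_, by simp⟩
      simp only [Finset.notMem_empty, Set.mem_univ, true_and, false_iff]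
      rintro rfl
      exact h (dvd_mul_right _ _)
  have h2 : (1 - PowerSeries.X ^ (j + 1)) *
      (PowerSeries.mk fun n => if j + 1 ∣ n then (1 : Polynomial ℤ) else 0) = 1 := by
    ext1 n
    rw [sub_mul, one_mul, map_sub, PowerSeries.coeff_X_pow_mul', PowerSeries.coeff_mk,
      PowerSeries.coeff_one]
    by_cases hn : j + 1 ≤ n
    · obtain ⟨m, rfl⟩ := Nat.exists_eq_add_of_le hn
      simp
    · have h0 : j + 1 ∣ n ↔ n = 0 :=
        ⟨fun h => Nat.eq_zero_of_dvd_of_lt h (by omega), fun h => h ▸ dvd_zero _⟩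
      simp [hn, h0]
  have h3 : HasGF (Set.univ : Set Bool) (fun b => if b then j else 0) (fun b => if b then 0 else 1)
      (PowerSeries.C Polynomial.X + PowerSeries.X ^ j) := by
    intro n
    refine ⟨Finset.univ.filter fun b => (if b then j else 0) = n, fun x => by simp, ?_⟩
    rw [Finset.sum_filter, Fintype.sum_bool, map_add, PowerSeries.coeff_C, PowerSeries.coeff_X_pow]
    simp [eq_comm, add_comm]
  have h4 := h1.prod h3
  rw [Set.univ_prod_univ] at h4
  refine ⟨_, h4.congr (fun x _ => rfl) (fun x _ => by simp), ?_⟩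
  rw [← mul_assoc, h2, one_mul]

end HasGF

end GeneratingFunctions

/-! ### Codes over a fixed word and their generating function. -/

section Codes

variable {ι : Type*}

/-- The letters of a list of codes, in order. A code `(e, B, o)` stands for a part with slack `e`
whose residue is given by the block of letters `B` and which is overlined if `o = true`. -/
def letters (c : List (ℕ × List ι × Bool)) : List ι :=
  c.flatMap fun x => x.2.1

/-- The number of non-overlined coded parts. -/
def numPlain (c : List (ℕ × List ι × Bool)) : ℕ :=
  c.countP fun x => !x.2.2

/-- Add a letter at the front of the first block. -/
def extendHead (a : ι) : List (ℕ × List ι × Bool) → List (ℕ × List ι × Bool)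
  | [] => []
  | x :: t => (x.1, a :: x.2.1, x.2.2) :: t

theorem letters_cons (x : ℕ × List ι × Bool) (t : List (ℕ × List ι × Bool)) :
    letters (x :: t) = x.2.1 ++ letters t := by
  simp [letters]

theorem extendHead_injOn (a : ι) : Set.InjOn (extendHead a) {c | c ≠ []} := by
  rintro (_ | ⟨⟨e, B, o⟩, t⟩) h (_ | ⟨⟨e', B', o'⟩, t'⟩) h' hc
  · rfl
  · exact absurd rfl h
  · exact absurd rfl h'
  · simpa [extendHead] using hc

theorem numPlain_extendHead (a : ι) (c : List (ℕ × List ι × Bool)) :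
    numPlain (extendHead a c) = numPlain c := by
  cases c <;> simp [extendHead, numPlain, List.countP_cons]

variable [LinearOrder ι]

/-- All blocks are nonempty and strictly decreasing. -/
def IsCode (c : List (ℕ × List ι × Bool)) : Prop :=
  ∀ x ∈ c, x.2.1 ≠ [] ∧ x.2.1.Pairwise (· > ·)

/-- `1` if the last letter of the block `B` exceeds the first letter of the following block, or if
no block follows. -/
def junction (B : List ι) : List (ℕ × List ι × Bool) → ℕ
  | [] => 1
  | x :: _ => if ∃ a ∈ B.getLast?, ∃ b ∈ x.2.1.head?, b < a then 1 else 0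

/-- The sum of the heights of the coded parts if `j` further parts precede them. -/
def codeStat (j : ℕ) : List (ℕ × List ι × Bool) → ℕ
  | [] => 0
  | x :: t => (j + 1) * (x.1 + (x.2.1.length - 1) + junction x.2.1 t) + (if x.2.2 then j else 0) +
      codeStat (j + 1) t

/-- The codes with given letters. -/
def codesOfWord (w : List ι) : Set (List (ℕ × List ι × Bool)) :=
  {c | IsCode c ∧ letters c = w}

theorem mem_codesOfWord {w : List ι} {c : List (ℕ × List ι × Bool)} :
    c ∈ codesOfWord w ↔ IsCode c ∧ letters c = w := Iff.rfl

theorem isCode_cons {x : ℕ × List ι × Bool} {t : List (ℕ × List ι × Bool)} :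
    IsCode (x :: t) ↔ (x.2.1 ≠ [] ∧ x.2.1.Pairwise (· > ·)) ∧ IsCode t :=
  List.forall_mem_cons

theorem headDescent_eq_zero_or_one (a : ι) (w : List ι) :
    headDescent a w = 0 ∨ headDescent a w = 1 := by
  cases w with
  | nil => exact Or.inl rfl
  | cons b w =>
    rw [headDescent]
    split_ifs
    · exact Or.inr rfl
    · exact Or.inl rfl

theorem codesOfWord_nil : codesOfWord ([] : List ι) = {[]} := by
  ext c
  rw [mem_codesOfWord, Set.mem_singleton_iff]
  constructor
  · rintro ⟨h1, h2⟩
    rcases c with _ | ⟨x, t⟩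
    · rfl
    · rw [letters_cons] at h2
      exact absurd (List.append_eq_nil_iff.1 h2).1 (isCode_cons.1 h1).1.1
  · rintro rfl
    exact ⟨by simp [IsCode], rfl⟩

theorem junction_singleton {a : ι} {w : List ι} {t : List (ℕ × List ι × Bool)}
    (ht : t ∈ codesOfWord w) :
    junction [a] t = if w = [] then 1 else headDescent a w := by
  obtain ⟨h1, rfl⟩ := ht
  rcases t with _ | ⟨x, t⟩
  · rfl
  · obtain ⟨e, B, o⟩ := x
    have h2 := (isCode_cons.1 h1).1.1
    rcases B with _ | ⟨b, B⟩
    · exact absurd rfl h2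
    · simp [junction, letters_cons, headDescent]

/-- The first letter either forms a block alone, with any slack and mark, or joins the first block
of a code of `w`, which stays decreasing exactly when there is an initial descent. -/
theorem codesOfWord_cons (a : ι) (w : List ι) :
    codesOfWord (a :: w) =
      (fun y : (ℕ × Bool) × List (ℕ × List ι × Bool) => (y.1.1, [a], y.1.2) :: y.2) ''
        (Set.univ ×ˢ codesOfWord w) ∪
      if headDescent a w = 1 then extendHead a '' codesOfWord w else ∅ := by
  ext c
  constructor
  · rintro ⟨h1, h2⟩
    rcases c with _ | ⟨⟨e, B, o⟩, t⟩
    · cases h2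
    obtain ⟨⟨h3, h4⟩, h5⟩ := isCode_cons.1 h1
    rw [letters_cons] at h2
    rcases B with _ | ⟨b, B⟩
    · exact absurd rfl h3
    obtain ⟨rfl, rfl⟩ := List.cons.inj h2
    rcases B with _ | ⟨b', B⟩
    · left
      exact ⟨((e, o), t), ⟨trivial, h5, rfl⟩, rfl⟩
    · right
      have h6 : b' < b := List.rel_of_pairwise_cons h4 List.mem_cons_self
      rw [if_pos (by simp [headDescent, h6])]
      refine ⟨(e, b' :: B, o) :: t, ⟨isCode_cons.2 ⟨⟨by simp, List.Pairwise.of_cons h4⟩, h5⟩, ?_⟩, rfl⟩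
      rw [letters_cons]
      rfl
  · rintro (⟨⟨⟨e, o⟩, t⟩, ⟨-, h1, rfl⟩, rfl⟩ | h)
    · exact ⟨isCode_cons.2 ⟨⟨by simp, by simp⟩, h1⟩, by rw [letters_cons]; rfl⟩
    · split_ifs at h with hd
      · obtain ⟨c, ⟨h1, rfl⟩, rfl⟩ := h
        rcases c with _ | ⟨⟨e, B, o⟩, t⟩
        · simp [headDescent, letters] at hd
        obtain ⟨⟨h3, h4⟩, h5⟩ := isCode_cons.1 h1
        rcases B with _ | ⟨b, B⟩
        · exact absurd rfl h3
        have hb : b < a := by simpa [headDescent, letters_cons] using hd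
        refine ⟨isCode_cons.2 ⟨⟨by simp, ?_⟩, h5⟩, by simp [extendHead, letters_cons]⟩
        rw [List.pairwise_cons]
        refine ⟨fun y hy => ?_, h4⟩
        rcases List.mem_cons.1 hy with rfl | hy
        · exact hb
        · exact (List.rel_of_pairwise_cons h4 hy).trans hb
      · exact h.elim

/-- The first block gains one letter but keeps its last one, so its junction is unchanged; the unit
of height gained is counted once for the part and once for each of the `j` parts before it. -/
theorem codeStat_extendHead (a : ι) (j : ℕ) {c : List (ℕ × List ι × Bool)} (hc : IsCode c)
    (hne : c ≠ []) : codeStat j (extendHead a c) = (j + 1) + codeStat j c := by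
  rcases c with _ | ⟨⟨e, B, o⟩, t⟩
  · exact absurd rfl hne
  · rcases B with _ | ⟨b, B⟩
    · exact absurd rfl (isCode_cons.1 hc).1.1
    · have h : junction (a :: b :: B) t = junction (b :: B) t := by
        cases t <;> simp [junction, List.getLast?_cons_cons]
      simp only [extendHead, codeStat, h, List.length_cons, Nat.add_sub_cancel]
      ring

open PowerSeries in
/-- The generating function of the codes with given letters. -/
theorem hasGF_codesOfWord {K : Type*} [Field K] [Algebra (PowerSeries (Polynomial ℤ)) K]
    {q d : K} (hq0 : q ≠ 0) (hq : ∀ j : ℕ, 1 - q ^ (j + 1) ≠ 0)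
    (hqX : algebraMap (PowerSeries (Polynomial ℤ)) K X = q)
    (hdX : algebraMap (PowerSeries (Polynomial ℤ)) K (C Polynomial.X) = d)
    (w : List ι) (j : ℕ) :
    ∃ p, HasGF (codesOfWord w) (codeStat j) numPlain p ∧
      overCoeff q d j * algebraMap _ K p = q ^ (wordExponent w + if w = [] then 0 else (j : ℤ)) *
        overCoeff q (d * q ^ descentNumber w) (w.length + j) := by
  induction w generalizing j with
  | nil =>
    rw [codesOfWord_nil]
    exact ⟨1, .singleton _ rfl rfl, by simp [wordExponent, descentNumber]⟩
  | cons a w ih =>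
    obtain ⟨g, hg, hg'⟩ := HasGF.slack j
    obtain ⟨p₁, hp₁, hp₁'⟩ := ih (j + 1)
    obtain ⟨p₂, hp₂, hp₂'⟩ := ih j
    -- `g` is the ratio of consecutive coefficients, so the factor `overCoeff q d j` carried in the
    -- statement absorbs one code at a time.
    have hgK : overCoeff q d j * algebraMap _ K g = overCoeff q d (j + 1) := by
      have h := congrArg (algebraMap _ K) hg'
      rw [map_mul, map_sub, map_one, map_pow, map_add, map_pow, hqX, hdX] at h
      rw [overCoeff_succ, ← h, mul_div_cancel_left₀ _ (hq j)]
    rw [codesOfWord_cons]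
    -- The junction of a lone block `[a]`: it is the initial descent, except that the end of the
    -- list counts as `1`.
    set i := if w = [] then 1 else headDescent a w with hi
    have h1 := ((hg.prod hp₁).shift ((j + 1) * i)).image
      (f := fun y : (ℕ × Bool) × List (ℕ × List ι × Bool) => (y.1.1, [a], y.1.2) :: y.2)
      (M₁ := codeStat j) (k₁ := numPlain)
      (by
        rintro ⟨⟨e, o⟩, t⟩ _ ⟨⟨e', o'⟩, t'⟩ _ h
        simp only [List.cons.injEq, Prod.mk.injEq, true_and] at h
        simp [h])
      (by
        rintro ⟨⟨e, o⟩, t⟩ ⟨-, ht⟩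
        simp only [codeStat, junction_singleton ht, ← hi, List.length_singleton]
        ring)
      (by
        rintro ⟨⟨e, o⟩, t⟩ _
        simp [numPlain, List.countP_cons]
        cases o <;> simp [add_comm])
    by_cases hd : headDescent a w = 1
    · rw [if_pos hd]
      have hw : w ≠ [] := by
        rintro rfl
        simp [headDescent] at hd
      have hne : ∀ c ∈ codesOfWord w, c ≠ [] := by
        rintro c ⟨-, h⟩ rfl
        exact hw h.symm
      have h2 := (hp₂.shift (j + 1)).image (M₁ := codeStat j) (k₁ := numPlain) (f := extendHead a)
        ((extendHead_injOn a).mono hne)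
        (fun c hc => codeStat_extendHead a j hc.1 (hne c hc))
        (fun c _ => numPlain_extendHead a c)
      refine ⟨_, h1.union h2 ?_, ?_⟩
      · rw [Set.disjoint_left]
        rintro _ ⟨y, -, rfl⟩ ⟨c, hc, hcy⟩
        rcases c with _ | ⟨⟨e, B, o⟩, t⟩
        · exact hne _ hc rfl
        · have hB := (isCode_cons.1 hc.1).1.1
          simp only [extendHead, List.cons.injEq, Prod.mk.injEq, true_and] at hcy
          exact hB hcy.1.2.1
      · rw [if_neg hw] at hp₁' hp₂' hi
        rw [hd] at hi
        rw [if_neg (List.cons_ne_nil a w), map_add, map_mul, map_mul, map_mul, map_pow, map_pow, hqX, hi,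
          mul_one, wordExponent, hd, descentNumber, hd, List.length_cons,
          show d * q ^ (1 + descentNumber w) = d * q ^ descentNumber w * q by ring,
          show w.length + 1 + j = w.length + j + 1 by ring, overCoeff_mul_eq_prefix hq]
        -- Cutting and not cutting at the descent supply coefficients of consecutive orders, which
        -- the prefix recurrence combines.
        have e1 : overCoeff q d j * (q ^ (j + 1) * (algebraMap _ K g * algebraMap _ K p₁) +
            q ^ (j + 1) * algebraMap _ K p₂) = q ^ (j + 1) *
              (overCoeff q d (j + 1) * algebraMap _ K p₁ + overCoeff q d j * algebraMap _ K p₂) := by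
          rw [← hgK]
          ring
        rw [e1, hp₁', hp₂', mul_add, mul_add, ← mul_assoc, ← mul_assoc, ← mul_assoc, ← mul_assoc,
          add_assoc w.length]
        simp only [← zpow_natCast, ← zpow_add₀ hq0]
        congr 3 <;> push_cast <;> ring
    · rw [if_neg hd, Set.union_empty]
      have hd0 : headDescent a w = 0 := by
        rcases headDescent_eq_zero_or_one a w with h | h
        · exact h
        · exact absurd h hd
      refine ⟨_, h1, ?_⟩
      have e1 : overCoeff q d j * (q ^ ((j + 1) * i) * (algebraMap _ K g * algebraMap _ K p₁)) =
          q ^ ((j + 1) * i) * (overCoeff q d (j + 1) * algebraMap _ K p₁) := by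
        rw [← hgK]
        ring
      rw [map_mul, map_mul, map_pow, hqX, e1, hp₁', if_neg (List.cons_ne_nil a w), wordExponent, descentNumber,
        hd0, zero_add, List.length_cons, ← mul_assoc, add_assoc w.length, add_comm 1 j]
      congr 1
      rw [← zpow_natCast, ← zpow_add₀ hq0]
      congr 1
      -- The extra `j + 1` in the exponent comes from the closing junction if `w` is empty, and from
      -- the induction hypothesis at `j + 1` otherwise.
      by_cases hw : w = []
      · rw [hi, if_pos hw, if_pos hw]
        push_cast
        ring
      · rw [hi, if_neg hw, if_neg hw, hd0]
        push_cast
        ring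

end Codes

/-! ### Constant words and the bijection between codes and one-letter families. -/

theorem headDescent_replicate {ι : Type*} [LinearOrder ι] (a : ι) (n : ℕ) :
    headDescent a (List.replicate n a) = 0 := by
  cases n <;> simp [headDescent, List.replicate_succ]

theorem descentNumber_replicate {ι : Type*} [LinearOrder ι] (a : ι) (n : ℕ) :
    descentNumber (List.replicate n a) = 0 := by
  induction n with
  | zero => rfl
  | succ n ih => rw [List.replicate_succ, descentNumber, ih, headDescent_replicate]

theorem wordExponent_replicate {ι : Type*} [LinearOrder ι] (a : ι) (n : ℕ) :
    wordExponent (List.replicate n a) = n := by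
  induction n with
  | zero => rfl
  | succ n ih =>
    rw [List.replicate_succ, wordExponent, ih, headDescent_replicate]
    push_cast
    ring

theorem wordWeight_replicate {ι K : Type*} [LinearOrder ι] [Field K] (q d : K) (a : ι) (n : ℕ) :
    wordWeight q d (List.replicate n a) = q ^ n * overCoeff q d n := by
  simp [wordWeight, wordExponent_replicate, descentNumber_replicate]

/-- The families of codes, one for each letter `i`, in which only the letter `i` is used. -/
def IsCodeFamily {r : ℕ} (f : Fin r → List (ℕ × List (Fin r) × Bool)) : Prop :=
  ∀ i, IsCode (f i) ∧ ∀ x ∈ letters (f i), x = i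

/-- A multiset of letters leaves a one-letter family only one word per index, so its generating
function is a product with one factor per letter. -/
theorem sum_coe_letters_eq_iff {r : ℕ} {f : Fin r → List (ℕ × List (Fin r) × Bool)}
    (hf : IsCodeFamily f) (u : Multiset (Fin r)) :
    ∑ i, (letters (f i) : Multiset (Fin r)) = u ↔
      ∀ i, letters (f i) = List.replicate (u.count i) i := by
  have hrep : ∀ i, letters (f i) = List.replicate (letters (f i)).length i :=
    fun i => List.eq_replicate_length.2 (hf i).2
  have hcount : ∀ i, (∑ j, (letters (f j) : Multiset (Fin r))).count i = (letters (f i)).length := by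
    intro i
    rw [Multiset.count_sum', Finset.sum_eq_single i]
    · rw [hrep i]
      simp
    · intro j _ hj
      rw [hrep j, Multiset.coe_count, List.count_replicate]
      simp [hj]
    · simp
  constructor
  · rintro rfl i
    rw [hcount, ← hrep]
  · intro h
    ext i
    rw [hcount, h, List.length_replicate]

open PowerSeries in
/-- The numbers of codes and of families of codes with given letters and statistics agree. -/
theorem nonempty_equiv_codes {r : ℕ} (u : Multiset (Fin r)) (n m : ℕ) :
    Nonempty ({c : List (ℕ × List (Fin r) × Bool) //
        (IsCode c ∧ (letters c : Multiset (Fin r)) = u) ∧ codeStat 0 c = n ∧ numPlain c = m} ≃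
      {f : Fin r → List (ℕ × List (Fin r) × Bool) //
        (IsCodeFamily f ∧ ∑ i, (letters (f i) : Multiset (Fin r)) = u) ∧
          ∑ i, codeStat 0 (f i) = n ∧ ∑ i, numPlain (f i) = m}) := by
  -- Weights have denominators and may carry negative powers of `q`, so the identity is proved in
  -- the fraction field and pulled back by injectivity.
  let K := FractionRing (PowerSeries (Polynomial ℤ))
  have hinj : Function.Injective (algebraMap (PowerSeries (Polynomial ℤ)) K) :=
    IsFractionRing.injective _ _
  set q : K := algebraMap (PowerSeries (Polynomial ℤ)) K X with hqX
  set d : K := algebraMap (PowerSeries (Polynomial ℤ)) K (C Polynomial.X) with hdX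
  have hq0 : q ≠ 0 := by
    rw [hqX, Ne, map_eq_zero_iff _ hinj]
    exact X_ne_zero
  have hq : ∀ j : ℕ, 1 - q ^ (j + 1) ≠ 0 := by
    intro j h
    rw [hqX, ← map_pow, ← map_one (algebraMap (PowerSeries (Polynomial ℤ)) K), ← map_sub,
      map_eq_zero_iff _ hinj] at h
    have := congrArg (constantCoeff (R := Polynomial ℤ)) h
    simp at this
  have hw : ∀ w : List (Fin r), ∃ p, HasGF (codesOfWord w) (codeStat 0) numPlain p ∧
      algebraMap _ K p = wordWeight q d w := by
    intro w
    obtain ⟨p, hp, hp'⟩ := hasGF_codesOfWord hq0 hq hqX.symm hdX.symm w 0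
    refine ⟨p, hp, ?_⟩
    simpa [overCoeff_zero, wordWeight] using hp'
  choose p hp hp' using hw
  have h1 : HasGF {c : List (ℕ × List (Fin r) × Bool) |
      IsCode c ∧ (letters c : Multiset (Fin r)) = u} (codeStat 0) numPlain
      (∑ w ∈ words u, p w) := by
    convert HasGF.biUnion (words u) codesOfWord p (fun w _ => hp w) ?_ using 1
    · ext c
      simp [mem_words, mem_codesOfWord]
    · intro w w' hww
      rw [Set.disjoint_left]
      intro c hc hc'
      exact hww (hc.2.symm.trans hc'.2)
  have h2 : HasGF {f : Fin r → List (ℕ × List (Fin r) × Bool) |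
      IsCodeFamily f ∧ ∑ i, (letters (f i) : Multiset (Fin r)) = u}
      (fun f => ∑ i, codeStat 0 (f i)) (fun f => ∑ i, numPlain (f i))
      (∏ i, p (List.replicate (u.count i) i)) := by
    convert HasGF.pi (fun i => codesOfWord (List.replicate (u.count i) i)) _ (fun i => hp _) using 1
    ext f
    constructor
    · rintro ⟨hf, hu⟩ i
      exact ⟨(hf i).1, (sum_coe_letters_eq_iff hf u).1 hu i⟩
    · intro hf
      have hf' : IsCodeFamily f := fun i => ⟨(hf i).1, fun x hx => by
        rw [(hf i).2] at hx
        exact List.eq_of_mem_replicate hx⟩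
      exact ⟨hf', (sum_coe_letters_eq_iff hf' u).2 fun i => (hf i).2⟩
  have h3 : ∑ w ∈ words u, p w = ∏ i, p (List.replicate (u.count i) i) := by
    apply hinj
    rw [map_sum, map_prod]
    simp only [hp', wordWeight_replicate]
    exact sum_wordWeight hq0 hq d u
  rw [h3] at h1
  exact h1.nonempty_equiv h2 n m

/-- A bijection between codes and families of codes that preserves all statistics. -/
theorem exists_codes_equiv (r : ℕ) :
    ∃ e : {c : List (ℕ × List (Fin r) × Bool) // IsCode c} ≃
        {f : Fin r → List (ℕ × List (Fin r) × Bool) // IsCodeFamily f},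
      ∀ c, ∑ i, (letters ((e c).1 i) : Multiset (Fin r)) = letters c.1 ∧
        ∑ i, codeStat 0 ((e c).1 i) = codeStat 0 c.1 ∧
        ∑ i, numPlain ((e c).1 i) = numPlain c.1 := by
  let φ : {c : List (ℕ × List (Fin r) × Bool) // IsCode c} → Multiset (Fin r) × ℕ × ℕ :=
    fun c => (letters c.1, codeStat 0 c.1, numPlain c.1)
  let ψ : {f : Fin r → List (ℕ × List (Fin r) × Bool) // IsCodeFamily f} →
      Multiset (Fin r) × ℕ × ℕ := fun f =>
    (∑ i, (letters (f.1 i) : Multiset (Fin r)), ∑ i, codeStat 0 (f.1 i), ∑ i, numPlain (f.1 i))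
  have h : ∀ t, Nonempty ({c // φ c = t} ≃ {f // ψ f = t}) := by
    rintro ⟨u, n, m⟩
    obtain ⟨e⟩ := nonempty_equiv_codes u n m
    have e₁ : {c // φ c = (u, n, m)} ≃ {c : List (ℕ × List (Fin r) × Bool) //
        (IsCode c ∧ (letters c : Multiset (Fin r)) = u) ∧ codeStat 0 c = n ∧ numPlain c = m} :=
      { toFun := fun c => ⟨c.1.1, by
          have := c.2
          simp only [φ, Prod.mk.injEq] at this
          exact ⟨⟨c.1.2, this.1⟩, this.2⟩⟩
        invFun := fun c => ⟨⟨c.1, c.2.1.1⟩, by simp only [φ, c.2.1.2, c.2.2.1, c.2.2.2]⟩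
        left_inv := fun _ => rfl
        right_inv := fun _ => rfl }
    have e₂ : {f // ψ f = (u, n, m)} ≃ {f : Fin r → List (ℕ × List (Fin r) × Bool) //
        (IsCodeFamily f ∧ ∑ i, (letters (f i) : Multiset (Fin r)) = u) ∧
          ∑ i, codeStat 0 (f i) = n ∧ ∑ i, numPlain (f i) = m} :=
      { toFun := fun f => ⟨f.1.1, by
          have := f.2
          simp only [ψ, Prod.mk.injEq] at this
          exact ⟨⟨f.1.2, this.1⟩, this.2⟩⟩
        invFun := fun f => ⟨⟨f.1, f.2.1.1⟩, by simp only [ψ, f.2.1.2, f.2.2.1, f.2.2.2]⟩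
        left_inv := fun _ => rfl
        right_inv := fun _ => rfl }
    exact ⟨(e₁.trans e).trans e₂.symm⟩
  refine ⟨Equiv.ofFiberEquiv fun t => (h t).some, fun c => ?_⟩
  have := Equiv.ofFiberEquiv_map (fun t => (h t).some) c
  simp only [φ, ψ, Prod.mk.injEq] at this
  exact this

/-! ### Residues, blocks and the difference condition. -/

section Decoding

variable {r : ℕ} {a : Fin r → ℤ} {N : ℤ}

/-- The hypotheses on `a` and `N` of the theorem. -/
structure Admissible (a : Fin r → ℤ) (N : ℤ) : Prop where
  super : ∀ k : Fin r, ∑ i ∈ Finset.univ.filter (fun i => i < k), a i < a k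
  sums : Set.InjOn (fun S : Finset (Fin r) => ∑ i ∈ S, a i) {S | S.Nonempty}
  pos : 0 < N
  le : ∑ i, a i ≤ N

/-- The sum of the elements of `A` given by a block of letters. -/
def blockSum (a : Fin r → ℤ) (B : List (Fin r)) : ℤ :=
  (B.map a).sum

theorem leastPosResidue_eq {α m : ℤ} (h0 : 0 < α) (hN : α ≤ N) (h : m ≡ -α [ZMOD N]) :
    leastPosResidue N (-m) = α := by
  have hl := leastPosResidue_spec (h0.trans_le hN) (-m)
  have hα : α ≡ -m [ZMOD N] := by
    have := h.neg
    rw [neg_neg] at this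
    exact this.symm
  refine le_antisymm (hl.2 ⟨h0, hα⟩) ?_
  by_contra hlt
  have hd := (hl.1.2.trans hα.symm).dvd
  have hpos := hl.1.1
  have := Int.le_of_dvd (by omega) hd
  omega

namespace Admissible

/-- At the first index the sum in `super` is empty, hence zero; later indices follow by induction.
-/
theorem a_pos (h : Admissible a N) (i : Fin r) : 0 < a i := by
  induction i using WellFoundedLT.induction with
  | _ i ih =>
    refine lt_of_le_of_lt (Finset.sum_nonneg fun j hj => ?_) (h.super i)
    exact (ih j (Finset.mem_filter.1 hj).2).le

theorem a_le (h : Admissible a N) (i : Fin r) : a i ≤ N :=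
  (Finset.single_le_sum (fun j _ => (h.a_pos j).le) (Finset.mem_univ i)).trans h.le

theorem a_mono (h : Admissible a N) {i j : Fin r} (hij : i ≤ j) : a i ≤ a j := by
  rcases hij.eq_or_lt with rfl | hij
  · exact le_rfl
  · refine (Finset.single_le_sum (f := a) (fun k _ => (h.a_pos k).le) ?_).trans (h.super j).le
    exact Finset.mem_filter.2 ⟨Finset.mem_univ _, hij⟩

theorem sum_lt (h : Admissible a N) {S : Finset (Fin r)} {k : Fin r} (hS : ∀ i ∈ S, i < k) :
    ∑ i ∈ S, a i < a k := by
  refine lt_of_le_of_lt (Finset.sum_le_sum_of_subset_of_nonneg ?_ fun i _ _ => (h.a_pos i).le)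
    (h.super k)
  intro i hi
  exact Finset.mem_filter.2 ⟨Finset.mem_univ _, hS i hi⟩

theorem sum_pos (h : Admissible a N) {S : Finset (Fin r)} (hS : S.Nonempty) : 0 < ∑ i ∈ S, a i :=
  Finset.sum_pos (fun i _ => h.a_pos i) hS

theorem sum_le (h : Admissible a N) (S : Finset (Fin r)) : ∑ i ∈ S, a i ≤ N :=
  (Finset.sum_le_sum_of_subset_of_nonneg (Finset.subset_univ S)
    fun i _ _ => (h.a_pos i).le).trans h.le

end Admissible

/-- A nonempty strictly decreasing list of letters. -/
def IsBlock (B : List (Fin r)) : Prop :=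
  B ≠ [] ∧ B.Pairwise (· > ·)

namespace IsBlock

variable {B : List (Fin r)}

theorem nodup (hB : IsBlock B) : B.Nodup :=
  hB.2.imp fun h => ne_of_gt h

theorem nonempty (hB : IsBlock B) : B.toFinset.Nonempty :=
  List.toFinset_nonempty_iff _ |>.2 hB.1

theorem blockSum_eq (hB : IsBlock B) (a : Fin r → ℤ) : blockSum a B = ∑ i ∈ B.toFinset, a i :=
  (List.sum_toFinset a hB.nodup).symm

theorem head_ge (hB : IsBlock B) : ∀ i ∈ B, i ≤ B.head hB.1 := by
  obtain ⟨h1, h2⟩ := hB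
  cases B with
  | nil => exact absurd rfl h1
  | cons b B =>
    intro i hi
    rcases List.mem_cons.1 hi with rfl | hi
    · exact le_rfl
    · exact (List.rel_of_pairwise_cons h2 hi).le

theorem getLast_le (hB : IsBlock B) : ∀ i ∈ B, B.getLast hB.1 ≤ i := by
  intro i hi
  obtain ⟨h1, h2⟩ := hB
  have h3 := List.dropLast_append_getLast h1
  rw [← h3] at h2 hi
  rw [List.pairwise_append] at h2
  rcases List.mem_append.1 hi with hi | hi
  · exact (h2.2.2 i hi _ (List.mem_singleton_self _)).le
  · rw [List.mem_singleton.1 hi]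

theorem blockSum_pos (hB : IsBlock B) (h : Admissible a N) : 0 < blockSum a B := by
  rw [hB.blockSum_eq]
  exact h.sum_pos hB.nonempty

theorem blockSum_le (hB : IsBlock B) (h : Admissible a N) : blockSum a B ≤ N := by
  rw [hB.blockSum_eq]
  exact h.sum_le _

theorem blockSum_mem (hB : IsBlock B) (a : Fin r → ℤ) : blockSum a B ∈ sumSet a :=
  ⟨_, hB.nonempty, (hB.blockSum_eq a).symm⟩

theorem summands_eq (hB : IsBlock B) (h : Admissible a N) :
    summands a (blockSum a B) = B.toFinset := by
  rw [hB.blockSum_eq]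
  exact summands_sum h.sums hB.nonempty

theorem sumWeight_eq (hB : IsBlock B) (h : Admissible a N) :
    sumWeight a (blockSum a B) = B.length := by
  rw [sumWeight, hB.summands_eq h, List.toFinset_card_of_nodup hB.nodup]

theorem sumMin_eq (hB : IsBlock B) (h : Admissible a N) :
    sumMin a (blockSum a B) = a (B.getLast hB.1) := by
  have hs := hB.summands_eq h
  have hne : (summands a (blockSum a B)).Nonempty := by
    rw [hs]
    exact hB.nonempty
  rw [sumMin, dif_pos hne]
  refine le_antisymm (Finset.inf'_le _ ?_) (Finset.le_inf' _ _ fun i hi => ?_)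
  · rw [hs, List.mem_toFinset]
    exact List.getLast_mem _
  · rw [hs, List.mem_toFinset] at hi
    exact h.a_mono (hB.getLast_le i hi)

/-- A block is determined by the residue class of its sum. -/
theorem eq_of_modEq {B' : List (Fin r)} (hB : IsBlock B) (hB' : IsBlock B') (h : Admissible a N)
    (hm : blockSum a B ≡ blockSum a B' [ZMOD N]) : B = B' := by
  have h1 := hB.blockSum_pos h
  have h2 := hB.blockSum_le h
  have h3 := hB'.blockSum_pos h
  have h4 := hB'.blockSum_le h
  have h5 : blockSum a B = blockSum a B' := by
    have e1 := leastPosResidue_eq h1 h2 (m := -blockSum a B) rfl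
    have e2 := leastPosResidue_eq h3 h4 (m := -blockSum a B) hm.neg
    rw [← e1, e2]
  rw [hB.blockSum_eq, hB'.blockSum_eq] at h5
  have h6 := h.sums hB.nonempty hB'.nonempty h5
  refine List.Perm.eq_of_pairwise (le := (· > ·)) ?_ hB.2 hB'.2 ?_
  · intro x y _ _ hxy hyx
    exact absurd hxy (lt_asymm hyx)
  · exact List.perm_of_nodup_nodup_toFinset_eq hB.nodup hB'.nodup h6

/-- The difference condition in terms of heights. -/
theorem gapCondition_iff {B' : List (Fin r)} (hB : IsBlock B) (hB' : IsBlock B')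
    (h : Admissible a N) {m m' : ℤ} {x y : ℕ × Bool} (hx : (x.1 : ℤ) = N * m - blockSum a B)
    (hy : (y.1 : ℤ) = N * m' - blockSum a B') :
    GapCondition a N x y ↔ m' + (B.length - 1) + overlineChi y +
      (if B'.head hB'.1 < B.getLast hB.1 then 1 else 0) ≤ m := by
  have hβ : leastPosResidue N (-(x.1 : ℤ)) = blockSum a B := by
    refine leastPosResidue_eq (hB.blockSum_pos h) (hB.blockSum_le h) ?_
    rw [hx]
    refine (Int.modEq_iff_dvd.2 ⟨-m, by ring⟩)
  rw [GapCondition, hβ, hB.sumWeight_eq h, hB.sumMin_eq h, hx, hy]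
  generalize overlineChi y = χ
  have h1 := hB'.blockSum_pos h
  have h2 := hB'.blockSum_le h
  have h3 := h.a_pos (B.getLast hB.1)
  have h4 := h.a_le (B.getLast hB.1)
  have h5 := h.pos
  -- The condition now reads `N * (m - m' - (|B| - 1 + χ)) ≥ a (last B) - blockSum a B'`. The right
  -- side lies strictly between `-N` and `N`, and is positive exactly when `head B' < last B`; so
  -- the integer factor must be at least `1` or `0` accordingly.
  split_ifs with hlt
  · have h6 : blockSum a B' < a (B.getLast hB.1) := by
      rw [hB'.blockSum_eq]
      refine h.sum_lt fun i hi => ?_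
      exact (hB'.head_ge i (List.mem_toFinset.1 hi)).trans_lt hlt
    constructor
    · intro hg
      by_contra hc
      have : m - m' - (B.length - 1 + χ) ≤ 0 := by omega
      nlinarith
    · intro hg
      have : 1 ≤ m - m' - (B.length - 1 + χ) := by omega
      nlinarith
  · have h6 : a (B.getLast hB.1) ≤ blockSum a B' := by
      refine (h.a_mono (not_lt.1 hlt)).trans ?_
      rw [hB'.blockSum_eq]
      exact Finset.single_le_sum (fun j _ => (h.a_pos j).le)
        (List.mem_toFinset.2 (List.head_mem hB'.1))
    constructor
    · intro hg
      by_contra hc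
      have : m - m' - (B.length - 1 + χ) ≤ -1 := by omega
      nlinarith
    · intro hg
      have : 0 ≤ m - m' - (B.length - 1 + χ) := by omega
      nlinarith

/-- The condition on the smallest part in terms of heights. -/
theorem last_iff (hB : IsBlock B) (h : Admissible a N) {m : ℤ} {x : ℕ × Bool}
    (hx : (x.1 : ℤ) = N * m - blockSum a B) :
    (x.1 : ℤ) ≥ N * (sumWeight a (leastPosResidue N (-(x.1 : ℤ))) - 1) ↔ (B.length : ℤ) ≤ m := by
  have hβ : leastPosResidue N (-(x.1 : ℤ)) = blockSum a B := by
    refine leastPosResidue_eq (hB.blockSum_pos h) (hB.blockSum_le h) ?_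
    rw [hx]
    refine (Int.modEq_iff_dvd.2 ⟨-m, by ring⟩)
  rw [hβ, hB.sumWeight_eq h, hx]
  have h1 := hB.blockSum_pos h
  have h2 := hB.blockSum_le h
  have h5 := h.pos
  constructor
  · intro hg
    by_contra hc
    have : m - (B.length - 1) ≤ 0 := by omega
    nlinarith
  · intro hg
    have : 1 ≤ m - (B.length - 1) := by omega
    nlinarith

theorem exists_of_mem_sumSet {α : ℤ} (hα : α ∈ sumSet a) : ∃ B, IsBlock B ∧ blockSum a B = α := by
  obtain ⟨S, hS, rfl⟩ := hα
  have hB : IsBlock (S.sort (· ≥ ·)) := by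
    constructor
    · intro hnil
      have := congrArg List.toFinset hnil
      rw [Finset.sort_toFinset] at this
      exact hS.ne_empty this
    · exact Finset.sortedGT_sort S |>.pairwise
  exact ⟨_, hB, by rw [hB.blockSum_eq, Finset.sort_toFinset]⟩

theorem isBlock_singleton (i : Fin r) : IsBlock [i] := ⟨by simp, by simp⟩

end IsBlock

/-- Under the difference conditions, parts decrease weakly and repeated parts are not
overlined. -/
theorem GapCondition.le {x y : ℕ × Bool} (hg : GapCondition a N x y) (h : Admissible a N)
    (hx : x.1 ∈ negResidueSet N (sumSet a)) : y.1 ≤ x.1 ∧ (x.1 = y.1 → y.2 = false) := by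
  obtain ⟨-, α, hα, hm⟩ := hx
  obtain ⟨B, hB, rfl⟩ := IsBlock.exists_of_mem_sumSet hα
  have h1 := hB.blockSum_pos h
  have h2 := hB.blockSum_le h
  have h3 := h.a_pos (B.getLast hB.1)
  rw [GapCondition, leastPosResidue_eq h1 h2 hm, hB.sumWeight_eq h, hB.sumMin_eq h] at hg
  -- For a singleton block, minimum and sum cancel; for a longer one, `N * (|B| - 1) ≥ N` outweighs
  -- the subtracted sum.
  have hlow : N * overlineChi y ≤ (x.1 : ℤ) - y.1 := by
    rcases B with _ | ⟨b, _ | ⟨c, B⟩⟩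
    · exact absurd rfl hB.1
    · simp [blockSum] at hg
      linarith
    · push_cast [List.length_cons] at hg
      have := h.pos
      nlinarith [Int.natCast_nonneg B.length]
  have := h.pos
  cases hy : y.2 with
  | false =>
    simp [overlineChi, hy] at hlow
    exact ⟨by omega, fun _ => rfl⟩
  | true =>
    simp [overlineChi, hy] at hlow
    exact ⟨by omega, fun _ => by omega⟩

/-- The parts of `-A_N` with a fixed residue: the difference condition is the defining condition
of an overpartition. -/
theorem gapCondition_iff_of_modEq (h : Admissible a N) (i : Fin r) {x y : ℕ × Bool}
    (hx : (x.1 : ℤ) ≡ -a i [ZMOD N]) (hy : (y.1 : ℤ) ≡ -a i [ZMOD N]) :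
    GapCondition a N x y ↔ y.1 ≤ x.1 ∧ (x.1 = y.1 → y.2 = false) := by
  have hB := IsBlock.isBlock_singleton i
  have hs : blockSum a [i] = a i := by simp [blockSum]
  have h1 := hB.sumWeight_eq h
  have h2 := hB.sumMin_eq h
  rw [hs] at h1 h2
  rw [GapCondition, leastPosResidue_eq (h.a_pos i) (h.a_le i) hx, h1, h2]
  have hN := h.pos
  -- The two sizes differ by `N * t`, and the difference condition becomes `t ≥ χ(y)`.
  obtain ⟨t, ht⟩ := (hy.trans hx.symm).dvd
  rw [ht]
  simp only [List.length_singleton, Nat.cast_one, sub_self, zero_add, List.getLast_singleton,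
    add_sub_cancel_right, ge_iff_le, mul_le_mul_iff_right₀ hN]
  cases hb : y.2 with
  | false =>
    simp only [overlineChi, hb, Bool.false_eq_true, if_false, implies_true, and_true]
    constructor
    · intro h0
      have := mul_nonneg hN.le h0
      omega
    · intro hle
      by_contra hc
      have : N * t < 0 := mul_neg_of_pos_of_neg hN (by omega)
      omega
  | true =>
    simp only [overlineChi, hb, if_true, Bool.true_eq_false, imp_false]
    constructor
    · intro h0
      have := mul_pos hN (show 0 < t by omega)
      omega
    · rintro ⟨hle, hne⟩
      by_contra hc
      have : N * t ≤ 0 := mul_nonpos_of_nonneg_of_nonpos hN.le (by omega)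
      omega

/-- Consecutive parts of an overpartition are related in the same way as all pairs of parts. -/
theorem isChain_iff_pairwise_overpartition (l : List (ℕ × Bool)) :
    l.IsChain (fun x y => y.1 ≤ x.1 ∧ (x.1 = y.1 → y.2 = false)) ↔
      l.Pairwise (fun x y => y.1 ≤ x.1 ∧ (x.1 = y.1 → y.2 = false)) := by
  have : Trans (fun x y : ℕ × Bool => y.1 ≤ x.1 ∧ (x.1 = y.1 → y.2 = false))
      (fun x y : ℕ × Bool => y.1 ≤ x.1 ∧ (x.1 = y.1 → y.2 = false))
      (fun x y : ℕ × Bool => y.1 ≤ x.1 ∧ (x.1 = y.1 → y.2 = false)) :=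
    ⟨fun {x y z} hxy hyz => ⟨hyz.1.trans hxy.1, fun hxz => hyz.2 (by omega)⟩⟩
  exact List.isChain_iff_pairwise

theorem isChain_gapCondition_iff_of_modEq (h : Admissible a N) (i : Fin r) {l : List (ℕ × Bool)}
    (hl : ∀ x ∈ l, (x.1 : ℤ) ≡ -a i [ZMOD N]) :
    l.IsChain (GapCondition a N) ↔
      l.Pairwise (fun x y => y.1 ≤ x.1 ∧ (x.1 = y.1 → y.2 = false)) := by
  rw [← isChain_iff_pairwise_overpartition]
  constructor
  · exact List.IsChain.imp_of_mem_imp fun x y hx hy =>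
      (gapCondition_iff_of_modEq h i (hl x hx) (hl y hy)).1
  · exact List.IsChain.imp_of_mem_imp fun x y hx hy =>
      (gapCondition_iff_of_modEq h i (hl x hx) (hl y hy)).2

/-- The conditions on the parts in the definition of `G`. -/
def IsGapList (a : Fin r → ℤ) (N : ℤ) (l : List (ℕ × Bool)) : Prop :=
  (∀ x ∈ l, x.1 ∈ negResidueSet N (sumSet a)) ∧ l.IsChain (GapCondition a N) ∧
    ∀ x ∈ l.getLast?, (x.1 : ℤ) ≥ N * (sumWeight a (leastPosResidue N (-(x.1 : ℤ))) - 1)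

theorem mem_overpartitionsG_iff (h : Admissible a N) {k n : ℕ} {l : List (ℕ × Bool)} :
    l ∈ overpartitionsG a N k n ↔
      IsGapList a N l ∧ (l.map Prod.fst).sum = n ∧ numNonOverlined l = k := by
  constructor
  · rintro ⟨⟨-, -, h1⟩, h2, h3⟩
    exact ⟨h3, h1, h2⟩
  · rintro ⟨h1, h2, h3⟩
    refine ⟨⟨fun x hx => (h1.1 x hx).1, ?_, h2⟩, h3, h1⟩
    rw [← isChain_iff_pairwise_overpartition]
    exact List.IsChain.imp_of_mem_imp (fun x y hx _ hg => hg.le h (h1.1 x hx)) h1.2.1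

/-- The overpartitions whose parts all have the residue of `-a i`. -/
def IsLetterList (a : Fin r → ℤ) (N : ℤ) (i : Fin r) (l : List (ℕ × Bool)) : Prop :=
  (∀ x ∈ l, 0 < x.1 ∧ (x.1 : ℤ) ≡ -a i [ZMOD N]) ∧
    l.Pairwise (fun x y => y.1 ≤ x.1 ∧ (x.1 = y.1 → y.2 = false))

theorem isGapList_of_isLetterList (h : Admissible a N) {i : Fin r} {l : List (ℕ × Bool)}
    (hl : IsLetterList a N i l) : IsGapList a N l := by
  have hB := IsBlock.isBlock_singleton i
  have hs : blockSum a [i] = a i := by simp [blockSum]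
  refine ⟨fun x hx => ⟨(hl.1 x hx).1, a i, hs ▸ hB.blockSum_mem a, (hl.1 x hx).2⟩,
    (isChain_gapCondition_iff_of_modEq h i fun x hx => (hl.1 x hx).2).2 hl.2, fun x hx => ?_⟩
  have h1 := hB.sumWeight_eq h
  rw [hs] at h1
  rw [leastPosResidue_eq (h.a_pos i) (h.a_le i) (hl.1 x (List.mem_of_getLast? hx)).2, h1]
  simp

theorem isLetterList_of_isGapList (h : Admissible a N) {i : Fin r} {l : List (ℕ × Bool)}
    (hl : IsGapList a N l) (hi : ∀ x ∈ l, (x.1 : ℤ) ≡ -a i [ZMOD N]) : IsLetterList a N i l :=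
  ⟨fun x hx => ⟨(hl.1 x hx).1, hi x hx⟩, (isChain_gapCondition_iff_of_modEq h i hi).1 hl.2.1⟩

/-- If `A` has one element, the two kinds of overpartitions coincide. -/
theorem overpartitionsF_eq_overpartitionsG {a : Fin 1 → ℤ} (h : Admissible a N) (k n : ℕ) :
    overpartitionsF a N k n = overpartitionsG a N k n := by
  have hS : sumSet a = {a 0} := by
    ext α
    constructor
    · rintro ⟨S, hS, rfl⟩
      obtain ⟨j, hj⟩ := hS
      have : S = {0} := by
        ext i
        obtain rfl := Subsingleton.elim j i
        simpa [Subsingleton.elim j 0] using hj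
      simp [this]
    · rintro rfl
      exact ⟨{0}, by simp, by simp⟩
  have hA : baseSet a = {a 0} := by
    rw [baseSet, Set.range_unique]
    rfl
  ext l
  constructor
  · rintro ⟨h1, h2, h3⟩
    have hl : IsLetterList a N 0 l := by
      refine ⟨fun x hx => ⟨h1.1 x hx, ?_⟩, h1.2.1⟩
      obtain ⟨-, s, hs, hx⟩ := h3 x hx
      rw [hA] at hs
      rwa [Set.mem_singleton_iff.1 hs] at hx
    exact ⟨h1, h2, isGapList_of_isLetterList h hl⟩
  · rintro ⟨h1, h2, h3, -⟩
    exact ⟨h1, h2, fun x hx => by rw [hA, ← hS]; exact h3 x hx⟩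

end Decoding

/-! ### Decoding lists of codes into gap lists. -/

section Decoding

variable {r : ℕ} {a : Fin r → ℤ} {N : ℤ}

/-- `1` if the first coded part is overlined and `0` otherwise. -/
def headOverlined {ι : Type*} : List (ℕ × List ι × Bool) → ℕ
  | [] => 0
  | x :: _ => if x.2.2 then 1 else 0

/-- The height of the first coded part. -/
def height {ι : Type*} [LinearOrder ι] : List (ℕ × List ι × Bool) → ℕ
  | [] => 0
  | x :: t => x.1 + (x.2.1.length - 1) + junction x.2.1 t + headOverlined t + height t

/-- The sum of the heights of the coded parts. -/
def heightSum {ι : Type*} [LinearOrder ι] : List (ℕ × List ι × Bool) → ℕ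
  | [] => 0
  | x :: t => height (x :: t) + heightSum t

/-- Heights accumulate from the tail: slack at position `j + 1` raises its own part and the `j`
parts before it, while an overline mark enters only the gaps above it and counts `j` times. -/
theorem codeStat_eq {ι : Type*} [LinearOrder ι] (j : ℕ) (c : List (ℕ × List ι × Bool)) :
    codeStat j c = heightSum c + j * (height c + headOverlined c) := by
  induction c generalizing j with
  | nil => rfl
  | cons x t ih =>
    rw [codeStat, ih, heightSum, height, headOverlined]
    split_ifs <;> ring

/-- The parts given by a list of codes. -/
def decode (a : Fin r → ℤ) (N : ℤ) : List (ℕ × List (Fin r) × Bool) → List (ℕ × Bool)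
  | [] => []
  | x :: t => ((N * height (x :: t) - blockSum a x.2.1).toNat, x.2.2) :: decode a N t

theorem numNonOverlined_decode (a : Fin r → ℤ) (N : ℤ) (c : List (ℕ × List (Fin r) × Bool)) :
    numNonOverlined (decode a N c) = numPlain c := by
  induction c with
  | nil => rfl
  | cons x t ih =>
    rw [numNonOverlined, numPlain] at *
    rw [decode, List.countP_cons, ih, List.countP_cons]

/-- The closing junction, or the positive height of the next part, makes up for the `1` subtracted
from the block length. -/
theorem length_le_height {x : ℕ × List (Fin r) × Bool} {t : List (ℕ × List (Fin r) × Bool)}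
    (hc : IsCode (x :: t)) : x.2.1.length ≤ height (x :: t) := by
  induction t generalizing x with
  | nil =>
    simp only [height, junction]
    omega
  | cons y t ih =>
    have h1 := ih (isCode_cons.1 hc).2
    have h2 := List.length_pos_iff.2 (isCode_cons.1 (isCode_cons.1 hc).2).1.1
    rw [height]
    omega

/-- Blocks of two or more letters have height at least `2` and sum at most `N`. A singleton may have
height `1`, and there `a i < N` is needed. -/
theorem decode_size_pos (h : Admissible a N) (hlt : ∀ i, a i < N) {x : ℕ × List (Fin r) × Bool}
    {t : List (ℕ × List (Fin r) × Bool)} (hc : IsCode (x :: t)) :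
    0 < N * height (x :: t) - blockSum a x.2.1 := by
  have hB : IsBlock x.2.1 := (isCode_cons.1 hc).1
  have h1 := length_le_height hc
  have h2 := hB.blockSum_le h
  have hN := h.pos
  rcases hB' : x.2.1 with _ | ⟨b, _ | ⟨c, B⟩⟩
  · exact absurd hB' hB.1
  · rw [hB'] at h1
    have h3 : (1 : ℤ) ≤ height (x :: t) := by exact_mod_cast h1
    have h4 := hlt b
    simp only [blockSum, List.map_singleton, List.sum_singleton]
    nlinarith
  · rw [← hB']
    rw [hB'] at h1
    simp only [List.length_cons] at h1
    have h3 : (2 : ℤ) ≤ height (x :: t) := by exact_mod_cast (by omega : 2 ≤ height (x :: t))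
    nlinarith

/-- The subtracted term sees only the multiset of letters, which is what allows words to be
rearranged. -/
theorem sum_decode (h : Admissible a N) (hlt : ∀ i, a i < N) {c : List (ℕ × List (Fin r) × Bool)}
    (hc : IsCode c) : ((((decode a N c).map Prod.fst).sum : ℕ) : ℤ) =
      N * codeStat 0 c - (Multiset.map a (letters c)).sum := by
  rw [codeStat_eq, zero_mul, add_zero]
  induction c with
  | nil => simp [decode, heightSum, letters]
  | cons x t ih =>
    have h1 := decode_size_pos h hlt hc
    rw [decode, List.map_cons, List.sum_cons, Nat.cast_add, ih (isCode_cons.1 hc).2,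
      Int.toNat_of_nonneg h1.le, heightSum, letters_cons, ← Multiset.coe_add, Multiset.map_add,
      Multiset.sum_add]
    simp only [blockSum, Multiset.map_coe, Multiset.sum_coe]
    push_cast
    ring

theorem junction_cons {B : List (Fin r)} (hB : IsBlock B) {y : ℕ × List (Fin r) × Bool}
    (hy : IsBlock y.2.1) (t : List (ℕ × List (Fin r) × Bool)) :
    junction B (y :: t) = if y.2.1.head hy.1 < B.getLast hB.1 then 1 else 0 := by
  rw [junction]
  simp [List.getLast?_eq_getLast_of_ne_nil hB.1, List.head?_eq_some_head hy.1]

theorem isGapList_cons_iff {x : ℕ × Bool} {l : List (ℕ × Bool)} :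
    IsGapList a N (x :: l) ↔ x.1 ∈ negResidueSet N (sumSet a) ∧ IsGapList a N l ∧
      (∀ y ∈ l.head?, GapCondition a N x y) ∧
      (l = [] → (x.1 : ℤ) ≥ N * (sumWeight a (leastPosResidue N (-(x.1 : ℤ))) - 1)) := by
  cases l with
  | nil => simp [IsGapList]
  | cons y l =>
    simp only [IsGapList, List.forall_mem_cons, List.isChain_cons_cons, List.getLast?_cons_cons]
    simp
    tauto

/-- A part is admissible in front of a decoded list if and only if its height is as large as that
of some code. -/
theorem gap_decode_iff (h : Admissible a N) (hlt : ∀ i, a i < N) {B : List (Fin r)} {m : ℤ}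
    {x : ℕ × Bool} {t : List (ℕ × List (Fin r) × Bool)} (hB : IsBlock B) (ht : IsCode t)
    (hx : (x.1 : ℤ) = N * m - blockSum a B) :
    ((∀ y ∈ (decode a N t).head?, GapCondition a N x y) ∧
      (decode a N t = [] → (x.1 : ℤ) ≥ N * (sumWeight a (leastPosResidue N (-(x.1 : ℤ))) - 1))) ↔
    ((B.length - 1 + junction B t + headOverlined t + height t : ℕ) : ℤ) ≤ m := by
  have hlen := List.length_pos_iff.2 hB.1
  cases t with
  | nil =>
    simp only [decode, List.head?_nil, Option.mem_def, reduceCtorEq, false_implies, implies_true,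
      true_and, forall_const, junction, headOverlined, height]
    -- The junction value `1` at the end of the list cancels the `- 1`, leaving exactly `B.length ≤
    -- m`.
    rw [hB.last_iff h hx]
    omega
  | cons y t =>
    have hy : IsBlock y.2.1 := (isCode_cons.1 ht).1
    have h1 := decode_size_pos h hlt ht
    have h2 : (((N * height (y :: t) - blockSum a y.2.1).toNat : ℕ) : ℤ) =
        N * height (y :: t) - blockSum a y.2.1 := Int.toNat_of_nonneg h1.le
    simp only [decode, List.head?_cons, Option.mem_def, Option.some.injEq, forall_eq', reduceCtorEq,
      false_implies, and_true]
    rw [hB.gapCondition_iff hy h hx h2, junction_cons hB hy]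
    have h3 : overlineChi ((N * height (y :: t) - blockSum a y.2.1).toNat, y.2.2) =
        (headOverlined (y :: t) : ℕ) := by
      simp only [overlineChi, headOverlined]
      split_ifs <;> rfl
    rw [h3]
    push_cast [Nat.cast_sub (Nat.succ_le_of_lt hlen)]
    constructor <;> intro h4 <;> linarith

theorem isGapList_decode (h : Admissible a N) (hlt : ∀ i, a i < N)
    {c : List (ℕ × List (Fin r) × Bool)} (hc : IsCode c) : IsGapList a N (decode a N c) := by
  induction c with
  | nil => simp [decode, IsGapList]
  | cons x t ih =>
    have hx : IsBlock x.2.1 := (isCode_cons.1 hc).1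
    have h1 := decode_size_pos h hlt hc
    have h2 : (((N * height (x :: t) - blockSum a x.2.1).toNat : ℕ) : ℤ) =
        N * height (x :: t) - blockSum a x.2.1 := Int.toNat_of_nonneg h1.le
    rw [decode, isGapList_cons_iff]
    refine ⟨⟨by omega, blockSum a x.2.1, hx.blockSum_mem a, ?_⟩, ih (isCode_cons.1 hc).2, ?_⟩
    · rw [h2]
      exact Int.modEq_iff_dvd.2 ⟨-height (x :: t), by ring⟩
    · rw [gap_decode_iff h hlt hx (isCode_cons.1 hc).2 h2, height]
      omega

theorem exists_decode_eq (h : Admissible a N) (hlt : ∀ i, a i < N) {l : List (ℕ × Bool)}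
    (hl : IsGapList a N l) : ∃ c, IsCode c ∧ decode a N c = l := by
  induction l with
  | nil => exact ⟨[], by simp [IsCode], rfl⟩
  | cons x l ih =>
    obtain ⟨⟨hpos, α, hα, hm⟩, h2, h3⟩ := isGapList_cons_iff.1 hl
    obtain ⟨t, ht, rfl⟩ := ih h2
    obtain ⟨B, hB, rfl⟩ := IsBlock.exists_of_mem_sumSet hα
    obtain ⟨m, hm⟩ := hm.symm.dvd
    have hx : (x.1 : ℤ) = N * m - blockSum a B := by linarith
    rw [gap_decode_iff h hlt hB ht hx] at h3
    -- The slack is the surplus of the height over its least admissible value.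
    obtain ⟨e, he⟩ := Int.le.dest h3
    refine ⟨(e, B, x.2) :: t, isCode_cons.2 ⟨hB, ht⟩, ?_⟩
    have hh : (height ((e, B, x.2) :: t) : ℤ) = m := by
      rw [← he, height]
      push_cast
      ring
    rw [decode, hh, ← hx]
    simp

/-- Once the tails agree, the residue of the first part gives its block, its size then gives the
height, and the height gives the slack. -/
theorem decode_injOn (h : Admissible a N) (hlt : ∀ i, a i < N) :
    Set.InjOn (decode a N) {c | IsCode c} := by
  intro c hc c' hc' hcc
  induction c generalizing c' with
  | nil =>
    cases c' with
    | nil => rfl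
    | cons x' t' => simp [decode] at hcc
  | cons x t ih =>
    cases c' with
    | nil => simp [decode] at hcc
    | cons x' t' =>
      have hcode : IsCode (x :: t) := hc
      have hcode' : IsCode (x' :: t') := hc'
      have h1 := decode_size_pos h hlt hcode
      have h2 := decode_size_pos h hlt hcode'
      simp only [decode, List.cons.injEq, Prod.mk.injEq] at hcc
      obtain ⟨⟨h3, h4⟩, h5⟩ := hcc
      obtain rfl := ih (isCode_cons.1 hcode).2 (isCode_cons.1 hcode').2 h5
      have h6 : N * height (x :: t) - blockSum a x.2.1 = N * height (x' :: t) - blockSum a x'.2.1 := by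
        omega
      have hB : x.2.1 = x'.2.1 := by
        refine IsBlock.eq_of_modEq (isCode_cons.1 hcode).1 (isCode_cons.1 hcode').1 h ?_
        exact Int.modEq_iff_dvd.2 ⟨(height (x' :: t) : ℤ) - height (x :: t), by linarith⟩
      rw [hB] at h6
      have h7 : (height (x :: t) : ℤ) = height (x' :: t) :=
        mul_left_cancel₀ h.pos.ne' (by linarith)
      rw [height, height, hB] at h7
      obtain ⟨e, B, o⟩ := x
      obtain ⟨e', B', o'⟩ := x'
      simp only at hB h4 h7
      have h8 : e = e' := by omega
      rw [hB, h4, h8]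

/-- A residue determines its block, so that of `-a i` forces `[i]`; conversely a strictly decreasing
block using only `i` is `[i]`. -/
theorem residue_decode (h : Admissible a N) (hlt : ∀ i, a i < N)
    {c : List (ℕ × List (Fin r) × Bool)} (hc : IsCode c) (i : Fin r) :
    (∀ x ∈ decode a N c, (x.1 : ℤ) ≡ -a i [ZMOD N]) ↔ ∀ j ∈ letters c, j = i := by
  induction c with
  | nil => simp [decode, letters]
  | cons x t ih =>
    have hx : IsBlock x.2.1 := (isCode_cons.1 hc).1
    have h1 := decode_size_pos h hlt hc
    have h2 : (((N * height (x :: t) - blockSum a x.2.1).toNat : ℕ) : ℤ) =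
        N * height (x :: t) - blockSum a x.2.1 := Int.toNat_of_nonneg h1.le
    rw [decode, List.forall_mem_cons, ih (isCode_cons.1 hc).2, letters_cons, List.forall_mem_append]
    refine and_congr_left fun _ => ?_
    rw [h2]
    have h3 : N * height (x :: t) - blockSum a x.2.1 ≡ -blockSum a x.2.1 [ZMOD N] :=
      Int.modEq_iff_dvd.2 ⟨-height (x :: t), by ring⟩
    constructor
    · intro h4
      have h5 : blockSum a x.2.1 ≡ blockSum a [i] [ZMOD N] := by
        have := (h3.symm.trans h4).neg
        simpa [blockSum] using this
      rw [hx.eq_of_modEq (IsBlock.isBlock_singleton i) h h5]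
      simp
    · intro h4
      have h5 : x.2.1 = [i] := by
        have h6 := hx.nodup
        rw [List.eq_replicate_length.2 h4] at h6 ⊢
        rw [List.nodup_replicate] at h6
        have h7 := List.length_pos_iff.2 hx.1
        rw [show x.2.1.length = 1 by omega]
        rfl
      refine h3.trans ?_
      rw [h5]
      simp [blockSum]

end Decoding

/-! ### Splitting by residue class, and the final count. -/

section Filtering

variable {r : ℕ} {a : Fin r → ℤ} {N : ℤ}

/-- The sublist of the parts with the residue of `-a i`. -/
def letterParts (a : Fin r → ℤ) (N : ℤ) (l : List (ℕ × Bool)) (i : Fin r) : List (ℕ × Bool) :=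
  l.filter fun x => decide ((x.1 : ℤ) ≡ -a i [ZMOD N])

/-- The overpartitions into parts from `-A_N`. -/
def IsBaseList (a : Fin r → ℤ) (N : ℤ) (l : List (ℕ × Bool)) : Prop :=
  (∀ x ∈ l, x.1 ∈ negResidueSet N (baseSet a)) ∧
    l.Pairwise (fun x y => y.1 ≤ x.1 ∧ (x.1 = y.1 → y.2 = false))

theorem coe_letterParts (a : Fin r → ℤ) (N : ℤ) (l : List (ℕ × Bool)) (i : Fin r) :
    (letterParts a N l i : Multiset (ℕ × Bool)) =
      Multiset.filter (fun x => (x.1 : ℤ) ≡ -a i [ZMOD N]) l := rfl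

theorem Multiset.sum_map_finsetSum {ι α M : Type*} [AddCommMonoid M] (I : Finset ι)
    (s : ι → Multiset α) (g : α → M) :
    (Multiset.map g (∑ i ∈ I, s i)).sum = ∑ i ∈ I, (Multiset.map g (s i)).sum :=
  map_sum (Multiset.sumAddMonoidHom.comp (Multiset.mapAddMonoidHom g)) s I

theorem Admissible.eq_of_modEq (h : Admissible a N) {i j : Fin r} {m : ℤ} (hi : m ≡ -a i [ZMOD N])
    (hj : m ≡ -a j [ZMOD N]) : i = j := by
  have h1 : blockSum a [i] ≡ blockSum a [j] [ZMOD N] := by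
    simpa [blockSum] using (hi.symm.trans hj).neg
  have h2 := (IsBlock.isBlock_singleton i).eq_of_modEq (IsBlock.isBlock_singleton j) h h1
  simpa using h2

theorem isLetterList_letterParts {l : List (ℕ × Bool)} (hl : IsBaseList a N l) (i : Fin r) :
    IsLetterList a N i (letterParts a N l i) := by
  refine ⟨fun x hx => ?_, hl.2.filter _⟩
  obtain ⟨h1, h2⟩ := List.mem_filter.1 hx
  exact ⟨(hl.1 x h1).1, of_decide_eq_true h2⟩

theorem sum_letterParts (h : Admissible a N) {l : List (ℕ × Bool)} (hl : IsBaseList a N l) :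
    ∑ i, (letterParts a N l i : Multiset (ℕ × Bool)) = l := by
  ext x
  rw [Multiset.count_sum']
  by_cases hx : x ∈ l
  · obtain ⟨-, _, ⟨i, rfl⟩, hi⟩ := hl.1 x hx
    rw [Finset.sum_eq_single i]
    · rw [coe_letterParts, Multiset.count_filter_of_pos
        (p := fun x : ℕ × Bool => (x.1 : ℤ) ≡ -a i [ZMOD N]) hi]
    · intro j _ hj
      rw [Multiset.count_eq_zero, Multiset.mem_coe, letterParts, List.mem_filter]
      rintro ⟨-, hx'⟩
      exact hj (h.eq_of_modEq (of_decide_eq_true hx') hi)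
    · simp
  · rw [Multiset.count_eq_zero_of_notMem (by simpa using hx)]
    refine Finset.sum_eq_zero fun i _ => ?_
    rw [Multiset.count_eq_zero, Multiset.mem_coe, letterParts, List.mem_filter]
    exact fun hx' => hx hx'.1

/-- The ordering relation is antisymmetric: if it holds both ways, the sizes agree and neither part
is overlined. -/
theorem eq_of_pairwise_overpartition {l l' : List (ℕ × Bool)}
    (hl : l.Pairwise (fun x y => y.1 ≤ x.1 ∧ (x.1 = y.1 → y.2 = false)))
    (hl' : l'.Pairwise (fun x y => y.1 ≤ x.1 ∧ (x.1 = y.1 → y.2 = false)))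
    (h : (l : Multiset (ℕ × Bool)) = l') : l = l' := by
  refine List.Perm.eq_of_pairwise ?_ hl hl' (Multiset.coe_eq_coe.1 h)
  rintro ⟨m, b⟩ ⟨m', b'⟩ _ _ ⟨h1, h2⟩ ⟨h3, h4⟩
  obtain rfl : m = m' := le_antisymm h3 h1
  have h5 : b' = false := h2 rfl
  have h6 : b = false := h4 rfl
  rw [h5, h6]

theorem letterParts_injOn (h : Admissible a N) :
    Set.InjOn (letterParts a N) {l | IsBaseList a N l} := by
  intro l hl l' hl' hll
  refine eq_of_pairwise_overpartition hl.2 hl'.2 ?_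
  rw [← sum_letterParts h hl, ← sum_letterParts h hl', hll]

theorem exists_letterParts_eq (h : Admissible a N) {f : Fin r → List (ℕ × Bool)}
    (hf : ∀ i, IsLetterList a N i (f i)) : ∃ l, IsBaseList a N l ∧ letterParts a N l = f := by
  set le : ℕ × Bool → ℕ × Bool → Bool :=
    fun x y => decide (y.1 < x.1 ∨ x.1 = y.1 ∧ (x.2 = true ∨ y.2 = false)) with hle
  set s : Multiset (ℕ × Bool) := ∑ i, (f i : Multiset (ℕ × Bool)) with hs
  set l := s.toList.mergeSort le with hl
  have hls : (l : Multiset (ℕ × Bool)) = s := by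
    rw [← Multiset.coe_toList s, Multiset.coe_eq_coe]
    exact List.mergeSort_perm _ _
  have hcount : ∀ x i, (x.1 : ℤ) ≡ -a i [ZMOD N] →
      (l : Multiset (ℕ × Bool)).count x = (f i : Multiset (ℕ × Bool)).count x := by
    intro x i hx
    rw [hls, hs, Multiset.count_sum', Finset.sum_eq_single i]
    · intro j _ hj
      rw [Multiset.count_eq_zero, Multiset.mem_coe]
      exact fun hxj => hj (h.eq_of_modEq ((hf j).1 x hxj).2 hx)
    · simp
  have hmem : ∀ x ∈ l, ∃ i, x ∈ f i := by
    intro x hx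
    have hx' : x ∈ s := by
      rw [← hls]
      exact hx
    rw [hs, Multiset.mem_sum] at hx'
    obtain ⟨i, -, hi⟩ := hx'
    exact ⟨i, hi⟩
  have hsorted : l.Pairwise fun x y => le x y = true := by
    refine List.pairwise_mergeSort ?_ ?_ _
    · rintro ⟨x, b⟩ ⟨y, c⟩ ⟨z, d⟩ hxy hyz
      simp only [hle, decide_eq_true_eq] at hxy hyz ⊢
      rcases hxy with hxy | ⟨hxy, hb⟩ <;> rcases hyz with hyz | ⟨hyz, hc⟩
      · left; omega
      · left; omega
      · left; omega
      · right
        refine ⟨hxy.trans hyz, ?_⟩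
        cases b <;> cases c <;> cases d <;> simp_all
    · rintro ⟨x, b⟩ ⟨y, c⟩
      simp only [hle, Bool.or_eq_true, decide_eq_true_eq]
      rcases lt_trichotomy x y with hxy | hxy | hxy
      · right; left; exact hxy
      · cases b <;> cases c <;> simp [hxy]
      · left; left; exact hxy
  have hpair : l.Pairwise (fun x y => y.1 ≤ x.1 ∧ (x.1 = y.1 → y.2 = false)) := by
    rw [List.pairwise_iff_forall_sublist]
    rintro x y hxy
    have h1 := List.pairwise_iff_forall_sublist.1 hsorted hxy
    simp only [hle, decide_eq_true_eq] at h1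
    refine ⟨by omega, fun he => ?_⟩
    by_contra hy
    rw [Bool.not_eq_false] at hy
    have hx : x.2 = true := by
      rcases h1 with h1 | ⟨-, h1 | h1⟩
      · omega
      · exact h1
      · rw [hy] at h1
        cases h1
    obtain rfl : x = y := Prod.ext he (hx.trans hy.symm)
    obtain ⟨i, hi⟩ := hmem x (hxy.subset (by simp))
    -- Two overlined copies of one size share a residue, so both would come from the same `f i`,
    -- which allows only one.
    have h2 : 2 ≤ (l : Multiset (ℕ × Bool)).count x :=
      Multiset.le_count_iff_replicate_le.2 (Multiset.replicate_le_coe.2 hxy)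
    rw [hcount x i ((hf i).1 x hi).2] at h2
    have h3 := List.pairwise_iff_forall_sublist.1 (hf i).2
      (Multiset.replicate_le_coe.1 (Multiset.le_count_iff_replicate_le.1 h2))
    have h4 := h3.2 rfl
    rw [hy] at h4
    cases h4
  refine ⟨l, ⟨fun x hx => ?_, hpair⟩, ?_⟩
  · obtain ⟨i, hi⟩ := hmem x hx
    exact ⟨((hf i).1 x hi).1, a i, ⟨i, rfl⟩, ((hf i).1 x hi).2⟩
  · funext i
    refine eq_of_pairwise_overpartition (hpair.filter _) (hf i).2 ?_
    ext x
    by_cases hx : (x.1 : ℤ) ≡ -a i [ZMOD N]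
    · rw [coe_letterParts, Multiset.count_filter_of_pos
        (p := fun x : ℕ × Bool => (x.1 : ℤ) ≡ -a i [ZMOD N]) hx, hcount x i hx]
    · rw [Multiset.count_eq_zero_of_notMem, Multiset.count_eq_zero_of_notMem]
      · exact fun hx' => hx ((hf i).1 x hx').2
      · intro hx'
        exact hx (of_decide_eq_true (List.mem_filter.1 hx').2)

theorem sum_eq_sum_letterParts (h : Admissible a N) {l : List (ℕ × Bool)}
    (hl : IsBaseList a N l) :
    (l.map Prod.fst).sum = ∑ i, ((letterParts a N l i).map Prod.fst).sum := by
  have h1 := congrArg (fun s : Multiset (ℕ × Bool) => (s.map Prod.fst).sum) (sum_letterParts h hl)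
  simp only [Multiset.sum_map_finsetSum, Multiset.map_coe, Multiset.sum_coe] at h1
  exact h1.symm

theorem numNonOverlined_eq_sum_letterParts (h : Admissible a N) {l : List (ℕ × Bool)}
    (hl : IsBaseList a N l) :
    numNonOverlined l = ∑ i, numNonOverlined (letterParts a N l i) := by
  have h1 := congrArg (Multiset.countPAddMonoidHom fun x : ℕ × Bool => (!x.2) = true)
    (sum_letterParts h hl)
  rw [map_sum] at h1
  simpa [numNonOverlined] using h1.symm

theorem isLetterList_decode (h : Admissible a N) (hlt : ∀ i, a i < N)
    {c : List (ℕ × List (Fin r) × Bool)} (hc : IsCode c) {i : Fin r} (hi : ∀ j ∈ letters c, j = i) :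
    IsLetterList a N i (decode a N c) :=
  isLetterList_of_isGapList h (isGapList_decode h hlt hc) ((residue_decode h hlt hc i).2 hi)

theorem exists_decode_eq_of_isLetterList (h : Admissible a N) (hlt : ∀ i, a i < N) {i : Fin r}
    {l : List (ℕ × Bool)} (hl : IsLetterList a N i l) :
    ∃ c, (IsCode c ∧ ∀ j ∈ letters c, j = i) ∧ decode a N c = l := by
  obtain ⟨c, hc, rfl⟩ := exists_decode_eq h hlt (isGapList_of_isLetterList h hl)
  exact ⟨c, ⟨hc, (residue_decode h hlt hc i).1 fun x hx => (hl.1 x hx).2⟩, rfl⟩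

/-- `G` counts codes. -/
theorem ncard_overpartitionsG (h : Admissible a N) (hlt : ∀ i, a i < N) (k n : ℕ) :
    (overpartitionsG a N k n).ncard =
      {c : List (ℕ × List (Fin r) × Bool) | IsCode c ∧
        N * codeStat 0 c - (Multiset.map a (letters c)).sum = n ∧ numPlain c = k}.ncard := by
  rw [← Set.InjOn.ncard_image ((decode_injOn h hlt).mono fun c hc => hc.1)]
  congr 1
  ext l
  rw [mem_overpartitionsG_iff h]
  constructor
  · rintro ⟨h1, h2, h3⟩
    obtain ⟨c, hc, rfl⟩ := exists_decode_eq h hlt h1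
    refine ⟨c, ⟨hc, ?_, ?_⟩, rfl⟩
    · rw [← sum_decode h hlt hc, h2]
    · rw [← numNonOverlined_decode a N c, h3]
  · rintro ⟨c, ⟨hc, h1, h2⟩, rfl⟩
    refine ⟨isGapList_decode h hlt hc, ?_, by rw [numNonOverlined_decode, h2]⟩
    rw [← sum_decode h hlt hc] at h1
    exact_mod_cast h1

/-- `F` counts families of codes. -/
theorem ncard_overpartitionsF (h : Admissible a N) (hlt : ∀ i, a i < N) (k n : ℕ) :
    (overpartitionsF a N k n).ncard =
      {f : Fin r → List (ℕ × List (Fin r) × Bool) | IsCodeFamily f ∧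
        N * (∑ i, codeStat 0 (f i) : ℕ) -
          (Multiset.map a (∑ i, (letters (f i) : Multiset (Fin r)))).sum = n ∧
        ∑ i, numPlain (f i) = k}.ncard := by
  have hF : ∀ l, l ∈ overpartitionsF a N k n ↔
      IsBaseList a N l ∧ (l.map Prod.fst).sum = n ∧ numNonOverlined l = k := by
    intro l
    constructor
    · rintro ⟨⟨-, h1, h2⟩, h3, h4⟩
      exact ⟨⟨h4, h1⟩, h2, h3⟩
    · rintro ⟨⟨h1, h2⟩, h3, h4⟩
      exact ⟨⟨fun x hx => (h1 x hx).1, h2, h3⟩, h4, h1⟩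
  have hsum : ∀ f : Fin r → List (ℕ × List (Fin r) × Bool), IsCodeFamily f →
      ((∑ i, ((decode a N (f i)).map Prod.fst).sum : ℕ) : ℤ) = N * (∑ i, codeStat 0 (f i) : ℕ) -
          (Multiset.map a (∑ i, (letters (f i) : Multiset (Fin r)))).sum := by
    intro f hf
    rw [Nat.cast_sum, Finset.sum_congr rfl fun i _ => sum_decode h hlt (hf i).1,
      Finset.sum_sub_distrib, ← Finset.mul_sum, Nat.cast_sum, Multiset.sum_map_finsetSum]
  have hinj : Set.InjOn (fun (f : Fin r → List (ℕ × List (Fin r) × Bool)) i => decode a N (f i))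
      {f | IsCodeFamily f} := by
    intro f hf f' hf' hff
    funext i
    exact decode_injOn h hlt (hf i).1 (hf' i).1 (congrFun hff i)
  rw [← Set.InjOn.ncard_image (hinj.mono fun f hf => hf.1),
    ← Set.InjOn.ncard_image ((letterParts_injOn h).mono fun l hl => ((hF l).1 hl).1)]
  congr 1
  ext g
  constructor
  · rintro ⟨l, hl, rfl⟩
    obtain ⟨h1, h2, h3⟩ := (hF l).1 hl
    choose f hf hfl using fun i => exists_decode_eq_of_isLetterList h hlt
      (isLetterList_letterParts h1 i)
    refine ⟨f, ⟨hf, ?_, ?_⟩, funext hfl⟩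
    · rw [← hsum f hf, ← h2, sum_eq_sum_letterParts h h1]
      simp only [hfl]
    · rw [← h3, numNonOverlined_eq_sum_letterParts h h1]
      simp only [← hfl, numNonOverlined_decode]
  · rintro ⟨f, ⟨hf, h1, h2⟩, rfl⟩
    obtain ⟨l, hl, hlf⟩ := exists_letterParts_eq h fun i =>
      isLetterList_decode h hlt (hf i).1 (hf i).2
    refine ⟨l, (hF l).2 ⟨hl, ?_, ?_⟩, hlf⟩
    · rw [sum_eq_sum_letterParts h hl, hlf]
      rw [← hsum f hf] at h1
      exact_mod_cast h1
    · rw [numNonOverlined_eq_sum_letterParts h hl, hlf, ← h2]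
      simp only [numNonOverlined_decode]

/-- Both conditions depend only on the statistics preserved by the bijection of
`exists_codes_equiv`. -/
theorem ncard_codes_eq_ncard_codeFamilies (a : Fin r → ℤ) (N : ℤ) (k n : ℕ) :
    {f : Fin r → List (ℕ × List (Fin r) × Bool) | IsCodeFamily f ∧
        N * (∑ i, codeStat 0 (f i) : ℕ) -
          (Multiset.map a (∑ i, (letters (f i) : Multiset (Fin r)))).sum = n ∧
        ∑ i, numPlain (f i) = k}.ncard =
      {c : List (ℕ × List (Fin r) × Bool) | IsCode c ∧
        N * codeStat 0 c - (Multiset.map a (letters c)).sum = n ∧ numPlain c = k}.ncard := by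
  obtain ⟨e, he⟩ := exists_codes_equiv r
  symm
  refine Set.ncard_congr (fun c hc => (e ⟨c, hc.1⟩).1) ?_ ?_ ?_
  · intro c hc
    obtain ⟨h1, h2, h3⟩ := he ⟨c, hc.1⟩
    refine ⟨(e ⟨c, hc.1⟩).2, ?_, ?_⟩
    · rw [h1, h2]
      exact hc.2.1
    · rw [h3]
      exact hc.2.2
  · intro c c' hc hc' hcc
    have := e.injective (Subtype.ext hcc)
    simpa using this
  · rintro f ⟨hf, h1, h2⟩
    obtain ⟨c, hc⟩ := e.surjective ⟨f, hf⟩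
    obtain ⟨h3, h4, h5⟩ := he c
    rw [hc] at h3 h4 h5
    refine ⟨c.1, ⟨c.2, ?_, ?_⟩, by rw [Subtype.coe_eta, hc]⟩
    · rw [← h3, ← h4]
      exact h1
    · rw [← h5]
      exact h2

end Filtering

theorem theorem5 {r : ℕ} (a : Fin r → ℤ) (N : ℤ)
    (ha_inj : Function.Injective a)
    (ha_super : ∀ k : Fin r, ∑ i ∈ Finset.univ.filter (fun i => i < k), a i < a k)
    (ha_sums : Set.InjOn (fun S : Finset (Fin r) => ∑ i ∈ S, a i) {S | S.Nonempty})
    (hN_pos : 0 < N) (hN : ∑ i, a i ≤ N) (k n : ℕ) :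
    (overpartitionsF a N k n).ncard = (overpartitionsG a N k n).ncard := by
  have h : Admissible a N := ⟨ha_super, ha_sums, hN_pos, hN⟩
  -- For `r = 1` the value `a 0 = N` is allowed and coding may break down. For `r ≥ 2` a second
  -- positive element forces `a i < N`, and for `r = 0` this is vacuous.
  by_cases hr : r = 1
  · subst hr
    rw [overpartitionsF_eq_overpartitionsG h]
  · have hlt : ∀ i, a i < N := by
      intro i
      obtain ⟨j, hj⟩ : ∃ j : Fin r, j ≠ i := by
        by_contra hc
        push Not at hc
        apply hr
        have := Fintype.card_eq_one_iff.2 ⟨i, hc⟩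
        rwa [Fintype.card_fin] at this
      have h1 := Finset.sum_le_sum_of_subset_of_nonneg (f := a) (Finset.subset_univ {j, i})
        fun x _ _ => (h.a_pos x).le
      rw [Finset.sum_pair hj] at h1
      have := h.a_pos j
      linarith
    rw [ncard_overpartitionsF h hlt, ncard_overpartitionsG h hlt, ncard_codes_eq_ncard_codeFamilies]
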